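/- **Theorem (Unitary representation of non-signalling teleportages).** All Hilbert spaces are finite dimensional. Let $N,d\ge 0$ be integers, let $\mathcal K_1,\dots,\mathcal K_N\neq 0$ be the input spaces of $N$ parties, $\mathcal H_d=\mathbb C^d$ the output space of each party, and $\mathcal K_B$ the space of a further party, Bob; write $\mathcal K=\bigotimes_j\mathcal K_j$. For $S\subseteq\{1,\dots,N\}$ put $\mathcal K_S=\bigotimes_{j\in S}\mathcal K_j$. *Definitions.* A *teleportage* for the parties in $S$ is a family of completely positive maps $T_{a}:\mathcal L(\mathcal K_S)\to\mathcal L(\mathcal K_B)$, indexed by the outcome strings $a=(a_j)_{j\in S}\in\{1,\dots,d\}^{S}$, with $\mathrm{tr}\sum_aT_a(\rho)=\mathrm{tr}\,\rho$ for all states $\rho$. A teleportage $\{T_{a_1,\dots,a_N}\}$ for all $N$ parties is *non-signalling* if for every bipartition $\{1,\dots,N\}=S\sqcup S^c$ (one part may be empty) there are a teleportage $\{T^{S}_{a_S}\}$ for $S$, a teleportage $\{T^{S^c}_{a_{S^c}}\}$ for $S^c$ and a state $\rho_B$ on $\mathcal K_B$ such that $$\sum_{a_{S^c}}T_{a_1,\dots,a_N}(\cdot)=T^S_{a_S}(\mathrm{tr}_{S^c}(\cdot)),\qquad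 \sum_{a_{S}}T_{a_1,\dots,a_N}(\cdot)=T^{S^c}_{a_{S^c}}(\mathrm{tr}_{S}(\cdot)),$$ and $\sum_{a_S}T^S_{a_S}(\sigma)=\rho_B$, $\sum_{a_{S^c}}T^{S^c}_{a_{S^c}}(\sigma)=\rho_B$ for all input states $\sigma$. A linear map $\Lambda:\mathcal L(\mathcal K\otimes\mathcal K_B)\to\mathcal L(\mathcal H_d^{\otimes N}\otimes\mathcal K_B)$ is a *channel* if it is completely positive and trace preserving; it is *causal* if for every subset $G$ of the $N+1$ parties there is a channel $\Gamma_G$ from the inputs of $G$ to the outputs of $G$ with $\mathrm{tr}_{G^c}\Lambda(\rho)=\Gamma_G(\mathrm{tr}_{G^c}\rho)$ for all states $\rho$. A teleportage is *channel-defined* by $\Lambda$ (with the unit vector $|0\rangle\in\mathcal K_B$) if, for some orthonormal bases $\{|a_k\rangle\}$ of the $N$ output spaces, $$T_{a_1,\dots,a_N}(\cdot)=\mathrm{tr}_{out_1,\dots,out_N}\Big\{\Big(\bigotimes_{k}|a_k\rangle\langle a_k|\otimes\mathbb 1_B\Big)\,\Lambda\big(\cdot\otimes|0\rangle\langle0|_B\big)\Big\}.$$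 A *unitary representation* of $\Lambda$ consists of an ancilla $E$ with input and output spaces $\mathcal H^E_{in},\mathcal H^E_{out}$, an ancilla $E'$ with space $\mathcal K_B$ (which is handed to Bob as his output), a unit vector $|R\rangle\in\mathcal H^E_{in}\otimes\mathcal K_B$, and a unitary $V:\mathcal K\otimes\mathcal H^E_{in}\to\mathcal H_d^{\otimes N}\otimes\mathcal H^E_{out}$ with $$\Lambda(\cdot)=\mathrm{tr}_{E_{out}}\big\{(V\otimes\mathbb 1_{E'})\,(\mathrm{tr}_{B_{in}}(\cdot)\otimes|R\rangle\langle R|_{EE'})\,(V\otimes\mathbb 1_{E'})^\dagger\big\},$$ such that for every permutation $\pi$ of $\{1,\dots,N\}$ there are ancilla spaces $\mathcal H^E_{in}=\mathcal H^{E}_{N},\dots,\mathcal H^{E}_{0}=\mathcal H^E_{out}$ and unitaries $U^\pi_{\pi(i),E}:\mathcal K_{\pi(i)}\otimes\mathcal H^{E}_{i}\to\mathcal H_d\otimes\mathcal H^{E}_{i-1}$, acting on party $\pi(i)$ and $E$ only and all depending on $\pi$, with $$(V\otimes\mathbb 1_{E'})\,(\psi\otimes|R\rangle)=\big(U^\pi_{\pi(1),E}U^\pi_{\pi(2),E}\cdots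 U^\pi_{\pi(N),E}\otimes\mathbb 1_{E'}\big)(\psi\otimes|R\rangle)\qquad\text{for all }\psi\in\mathcal K ,$$ that is, $V$ factors in every order of the parties on the prepared ancilla state $|R\rangle$. (In particular, for any one given $\pi$, $V$ may be chosen equal to the product.) *Statement.* Let $\{T_{a_1,\dots,a_N}\}$ be a teleportage for the $N$ parties. 1. $\{T_{a_1,\dots,a_N}\}$ is non-signalling if and only if it is channel-defined by some map $\Lambda$ that has a unitary representation. 2. Every $\Lambda$ that has a unitary representation is a causal channel. 3. If $\{T_{a_1,\dots,a_N}\}$ is channel-defined by a causal channel $\Lambda$ with the vector $|0\rangle$, then the channel $X\mapsto\Lambda(\mathrm{tr}_B X\otimes|0\rangle\langle 0|)$, which agrees with $\Lambda$ when Bob's input is $|0\rangle$, has a unitary representation. -/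

import Mathlib

/-!
Finite-dimensional Hilbert spaces are given in coordinates: a space is `ℂⁿ` for a finite index
type `n`, operators from `ℂⁿ` to `ℂᵐ` are matrices, and tensor products are indexed by product
types. The input space of party `j` is indexed by `κ j`, the joint input space `⊗ⱼ 𝒦ⱼ` by
`∀ j, κ j`, the joint output space `ℋ_d^{⊗N}` by `ι → Fin d`, Bob's space by `β`.
-/

open scoped Kronecker ComplexOrder

namespace Teleportage

section General

variable {m n α α' : Type*} [Fintype m] [Fintype n] [Fintype α] [Fintype α']

/-- Density operators. -/
def IsDensity (ρ : Matrix n n ℂ) : Prop := ρ.PosSemidef ∧ ρ.trace = 1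

/-- The rank-one operator `|v⟩⟨v|`. -/
def pureState {n : Type*} (v : EuclideanSpace ℂ n) : Matrix n n ℂ :=
  Matrix.of fun i j => v i * star (v j)

/-- The ampliation `Φ ⊗ id_k`. -/
def ampliation (Φ : Matrix m m ℂ →ₗ[ℂ] Matrix n n ℂ) (k : ℕ)
    (X : Matrix (m × Fin k) (m × Fin k) ℂ) : Matrix (n × Fin k) (n × Fin k) ℂ :=
  Matrix.of fun p q => Φ (Matrix.of fun i j => X (i, p.2) (j, q.2)) p.1 q.1

/-- Complete positivity: every ampliation preserves positive semidefiniteness. -/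
def IsCP (Φ : Matrix m m ℂ →ₗ[ℂ] Matrix n n ℂ) : Prop :=
  ∀ (k : ℕ) (X : Matrix (m × Fin k) (m × Fin k) ℂ), X.PosSemidef → (ampliation Φ k X).PosSemidef

/-- Quantum channels: completely positive trace-preserving maps. -/
def IsChannel (Φ : Matrix m m ℂ →ₗ[ℂ] Matrix n n ℂ) : Prop :=
  IsCP Φ ∧ ∀ X, (Φ X).trace = X.trace

/-- Partial trace over the first tensor factor. -/
def traceFst {β : Type*} (X : Matrix (α × β) (α × β) ℂ) : Matrix β β ℂ :=
  Matrix.of fun b c => ∑ x, X (x, b) (x, c)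

/-- Partial trace over the second tensor factor. -/
def traceSnd {β : Type*} [Fintype β] (X : Matrix (α' × β) (α' × β) ℂ) : Matrix α' α' ℂ :=
  Matrix.of fun x y => ∑ b, X (x, b) (y, b)

/-- Unitary operators between two spaces of equal dimension. -/
def IsUnitaryOp [DecidableEq m] [DecidableEq n] (V : Matrix m n ℂ) : Prop :=
  V.conjTranspose * V = 1 ∧ V * V.conjTranspose = 1

/-- The linear map `X ↦ tr_B(X) ⊗ |v⟩⟨v|` that discards Bob's input and replaces it by `|v⟩`. -/
def resetBob {α β : Type*} [Fintype β] (v : EuclideanSpace ℂ β) :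
    Matrix (α × β) (α × β) ℂ →ₗ[ℂ] Matrix (α × β) (α × β) ℂ where
  toFun X := traceSnd X ⊗ₖ pureState v
  map_add' X Y := by
    ext ⟨x, b⟩ ⟨y, c⟩
    simp [traceSnd, Matrix.kroneckerMap_apply, Finset.sum_add_distrib, add_mul]
  map_smul' r X := by
    ext ⟨x, b⟩ ⟨y, c⟩
    simp [traceSnd, Matrix.kroneckerMap_apply, ← Finset.mul_sum, mul_assoc]

end General

section Parties

variable {ι : Type*} [Fintype ι] [DecidableEq ι]

/-- The joint configuration that is `x` on the parties in `S` and `z` on the others. -/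
def glue {κ : ι → Type*} (S : Finset ι) (x : ∀ j : {j // j ∈ S}, κ j)
    (z : ∀ j : {j // j ∉ S}, κ j) : ∀ j, κ j :=
  fun j => if h : j ∈ S then x ⟨j, h⟩ else z ⟨j, h⟩

/-- Partial trace over the parties outside `S`; what remains is an operator on the parties in `S`
and on a further system indexed by `β`. -/
def keep {κ : ι → Type*} [∀ j, Fintype (κ j)] {β : Type*} (S : Finset ι)
    (X : Matrix ((∀ j, κ j) × β) ((∀ j, κ j) × β) ℂ) :
    Matrix ((∀ j : {j // j ∈ S}, κ j) × β) ((∀ j : {j // j ∈ S}, κ j) × β) ℂ :=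
  Matrix.of fun p q =>
    ∑ z : ∀ j : {j // j ∉ S}, κ j, X (glue S p.1 z, p.2) (glue S q.1 z, q.2)

/-- Partial trace over the parties outside `S`. -/
def traceCompl {κ : ι → Type*} [∀ j, Fintype (κ j)] (S : Finset ι)
    (X : Matrix (∀ j, κ j) (∀ j, κ j) ℂ) :
    Matrix (∀ j : {j // j ∈ S}, κ j) (∀ j : {j // j ∈ S}, κ j) ℂ :=
  Matrix.of fun x y => ∑ z : ∀ j : {j // j ∉ S}, κ j, X (glue S x z) (glue S y z)

/-- Partial trace over the parties in `S`. -/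
def traceOn {κ : ι → Type*} [∀ j, Fintype (κ j)] (S : Finset ι)
    (X : Matrix (∀ j, κ j) (∀ j, κ j) ℂ) :
    Matrix (∀ j : {j // j ∉ S}, κ j) (∀ j : {j // j ∉ S}, κ j) ℂ :=
  Matrix.of fun x y => ∑ z : ∀ j : {j // j ∈ S}, κ j, X (glue S z x) (glue S z y)

/-- Teleportages: instruments from the parties' joint input space to Bob's space whose outcomes are
the strings `(a₁, …, a_N)`. -/
def IsTeleportage {d : ℕ} {κ : ι → Type*} [∀ j, Fintype (κ j)] {β : Type*} [Fintype β]
    (T : (ι → Fin d) → Matrix (∀ j, κ j) (∀ j, κ j) ℂ →ₗ[ℂ] Matrix β β ℂ) : Prop :=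
  (∀ a, IsCP (T a)) ∧
    ∀ ρ : Matrix (∀ j, κ j) (∀ j, κ j) ℂ, IsDensity ρ → (∑ a, T a ρ).trace = ρ.trace

/-- `T` does not permit signalling across the bipartition of the parties into `S` and its
complement. -/
def NoSignallingAcross {d : ℕ} {κ : ι → Type*} [∀ j, Fintype (κ j)] {β : Type*} [Fintype β]
    (T : (ι → Fin d) → Matrix (∀ j, κ j) (∀ j, κ j) ℂ →ₗ[ℂ] Matrix β β ℂ) (S : Finset ι) : Prop :=
  ∃ (T₁ : ({j // j ∈ S} → Fin d) →
        Matrix (∀ j : {j // j ∈ S}, κ j) (∀ j : {j // j ∈ S}, κ j) ℂ →ₗ[ℂ] Matrix β β ℂ)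
    (T₂ : ({j // j ∉ S} → Fin d) →
        Matrix (∀ j : {j // j ∉ S}, κ j) (∀ j : {j // j ∉ S}, κ j) ℂ →ₗ[ℂ] Matrix β β ℂ)
    (ρB : Matrix β β ℂ),
    IsTeleportage T₁ ∧ IsTeleportage T₂ ∧ IsDensity ρB ∧
    (∀ σ, IsDensity σ → ∑ a, T₁ a σ = ρB) ∧
    (∀ σ, IsDensity σ → ∑ a, T₂ a σ = ρB) ∧
    (∀ a X, ∑ c : {j // j ∉ S} → Fin d, T (glue S a c) X = T₁ a (traceCompl S X)) ∧
    (∀ c X, ∑ a : {j // j ∈ S} → Fin d, T (glue S a c) X = T₂ c (traceOn S X))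

/-- Non-signalling teleportages: no signalling across any bipartition of the parties, the trivial
bipartition included (it says that the parties together cannot signal to Bob). -/
def IsNonSignalling {d : ℕ} {κ : ι → Type*} [∀ j, Fintype (κ j)] {β : Type*} [Fintype β]
    (T : (ι → Fin d) → Matrix (∀ j, κ j) (∀ j, κ j) ℂ →ₗ[ℂ] Matrix β β ℂ) : Prop :=
  ∀ S : Finset ι, NoSignallingAcross T S

/-- A map on the systems of the parties in `ι` and of Bob is causal: for every group of the
`|ι| + 1` parties (a set `S`, without or with Bob) the reduced output of the group arises by a
channel from the reduced input of the group. -/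
def IsCausal {d : ℕ} {κ : ι → Type*} [∀ j, Fintype (κ j)] {β : Type*} [Fintype β]
    (Λ : Matrix ((∀ j, κ j) × β) ((∀ j, κ j) × β) ℂ →ₗ[ℂ]
      Matrix ((ι → Fin d) × β) ((ι → Fin d) × β) ℂ) : Prop :=
  ∀ S : Finset ι,
    (∃ Γ : Matrix (∀ j : {j // j ∈ S}, κ j) (∀ j : {j // j ∈ S}, κ j) ℂ →ₗ[ℂ]
        Matrix ({j // j ∈ S} → Fin d) ({j // j ∈ S} → Fin d) ℂ,
      IsChannel Γ ∧ ∀ ρ, IsDensity ρ →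
        traceCompl (κ := fun _ => Fin d) S (traceSnd (Λ ρ)) = Γ (traceCompl S (traceSnd ρ))) ∧
    (∃ Γ : Matrix ((∀ j : {j // j ∈ S}, κ j) × β) ((∀ j : {j // j ∈ S}, κ j) × β) ℂ →ₗ[ℂ]
        Matrix (({j // j ∈ S} → Fin d) × β) (({j // j ∈ S} → Fin d) × β) ℂ,
      IsChannel Γ ∧ ∀ ρ, IsDensity ρ →
        keep (κ := fun _ => Fin d) S (Λ ρ) = Γ (keep S ρ))

/-- The projector `⊗ₖ |aₖ⟩⟨aₖ|` for orthonormal bases `bs k` of the output spaces. -/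
noncomputable def outcomeProj {d : ℕ} (bs : ι → OrthonormalBasis (Fin d) ℂ (EuclideanSpace ℂ (Fin d)))
    (a : ι → Fin d) : Matrix (ι → Fin d) (ι → Fin d) ℂ :=
  Matrix.of fun x y => ∏ k, bs k (a k) (x k) * star (bs k (a k) (y k))

/-- `T_a(ρ) = tr_{out₁…out_N} { (⊗ₖ |aₖ⟩⟨aₖ| ⊗ 1_B) Λ(ρ ⊗ |0⟩⟨0|_B) }` for the given bases and the
given vector `|0⟩`. -/
def DefinedVia {d : ℕ} {κ : ι → Type*} {β : Type*} [Fintype β] [DecidableEq β]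
    (T : (ι → Fin d) → Matrix (∀ j, κ j) (∀ j, κ j) ℂ →ₗ[ℂ] Matrix β β ℂ)
    (Λ : Matrix ((∀ j, κ j) × β) ((∀ j, κ j) × β) ℂ →ₗ[ℂ]
      Matrix ((ι → Fin d) × β) ((ι → Fin d) × β) ℂ)
    (bs : ι → OrthonormalBasis (Fin d) ℂ (EuclideanSpace ℂ (Fin d)))
    (ket0 : EuclideanSpace ℂ β) : Prop :=
  ∀ a ρ, T a ρ = traceFst ((outcomeProj bs a ⊗ₖ (1 : Matrix β β ℂ)) * Λ (ρ ⊗ₖ pureState ket0))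

/-- `T` is channel-defined by the map `Λ`. -/
def IsChannelDefinedBy {d : ℕ} {κ : ι → Type*} {β : Type*} [Fintype β] [DecidableEq β]
    (T : (ι → Fin d) → Matrix (∀ j, κ j) (∀ j, κ j) ℂ →ₗ[ℂ] Matrix β β ℂ)
    (Λ : Matrix ((∀ j, κ j) × β) ((∀ j, κ j) × β) ℂ →ₗ[ℂ]
      Matrix ((ι → Fin d) × β) ((ι → Fin d) × β) ℂ) : Prop :=
  ∃ (bs : ι → OrthonormalBasis (Fin d) ℂ (EuclideanSpace ℂ (Fin d))) (ket0 : EuclideanSpace ℂ β),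
    ‖ket0‖ = 1 ∧ DefinedVia T Λ bs ket0

end Parties

section Sequence

variable {N d : ℕ} {κ : Fin N → Type*}

/-- Index type of the intermediate space at time `t` when the parties act in the order
`σ 0, σ 1, …`: the parties `σ i` with `i < t` hold outputs, the others still hold inputs, and the
ancilla has dimension `e`. -/
abbrev Stage (d : ℕ) (κ : Fin N → Type*) (σ : Equiv.Perm (Fin N)) (t e : ℕ) : Type _ :=
  (({i : Fin N // i.val < t} → Fin d) × (∀ i : {i : Fin N // t ≤ i.val}, κ (σ i))) × Fin e

/-- The operator on the whole system in which party `σ t` and the ancilla undergo `U`, and the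
identity acts on all other parties. -/
def localStep [∀ j, DecidableEq (κ j)] (σ : Equiv.Perm (Fin N)) (t : Fin N) {e f : ℕ}
    (U : Matrix (Fin d × Fin f) (κ (σ t) × Fin e) ℂ) :
    Matrix (Stage d κ σ (t.val + 1) f) (Stage d κ σ t.val e) ℂ :=
  Matrix.of fun p q =>
    if (∀ i : {i : Fin N // i.val < t.val}, p.1.1 ⟨i.1, i.2.trans (Nat.lt_succ_self _)⟩ = q.1.1 i) ∧
        (∀ i : {i : Fin N // t.val + 1 ≤ i.val},
          p.1.2 i = q.1.2 ⟨i.1, (Nat.le_succ _).trans i.2⟩)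
    then U (p.1.1 ⟨t, Nat.lt_succ_self _⟩, p.2) (q.1.2 ⟨t, le_refl _⟩, q.2)
    else 0

/-- The composite `U_{t-1} ⋯ U_1 U_0` of the first `t` local steps. -/
def composite [∀ j, Fintype (κ j)] [∀ j, DecidableEq (κ j)] (σ : Equiv.Perm (Fin N)) (e : ℕ → ℕ)
    (U : ∀ t : Fin N, Matrix (Fin d × Fin (e (t.val + 1))) (κ (σ t) × Fin (e t.val)) ℂ) :
    (t : ℕ) → t ≤ N → Matrix (Stage d κ σ t (e t)) (Stage d κ σ 0 (e 0)) ℂ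
  | 0, _ => 1
  | t + 1, h => localStep σ ⟨t, h⟩ (U ⟨t, h⟩) * composite σ e U t (Nat.le_of_succ_le h)

/-- `W = U_{σ(N-1)} ⋯ U_{σ(1)} U_{σ(0)}` for unitaries `U_k : 𝒦_k ⊗ E_t → ℋ_d ⊗ E_{t+1}`
(with `k = σ(t)`) that each act on one party and the ancilla, for suitable intermediate ancilla
spaces. The re-indexing identifies the first and last stages with the joint input and output. -/
def IsSequential [∀ j, Fintype (κ j)] [∀ j, DecidableEq (κ j)] (σ : Equiv.Perm (Fin N))
    {ein eout : ℕ} (W : Matrix ((Fin N → Fin d) × Fin eout) ((∀ j, κ j) × Fin ein) ℂ) : Prop :=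
  ∃ (e : ℕ → ℕ) (h0 : ein = e 0) (hN : eout = e N)
    (U : ∀ t : Fin N, Matrix (Fin d × Fin (e (t.val + 1))) (κ (σ t) × Fin (e t.val)) ℂ),
    (∀ t, IsUnitaryOp (U t)) ∧
    W = (composite σ e U N le_rfl).submatrix
      (fun p => ((fun i => p.1 (σ i.1), fun i => absurd i.1.isLt (not_lt.mpr i.2)), Fin.cast hN p.2))
      (fun q => ((fun i => absurd i.2 (Nat.not_lt_zero _), fun i => q.1 (σ i.1)), Fin.cast h0 q.2))

end Sequence

section Representation

variable {α δ β : Type*} {ein eout : ℕ}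

/-- `(V ⊗ 1_{E'}) (X ⊗ |R⟩⟨R|_{E,E'}) (V ⊗ 1_{E'})†`, where `V` acts on the parties and on `E`. -/
def evolve [Fintype α] [Fintype β] [DecidableEq β]
    (V : Matrix (δ × Fin eout) (α × Fin ein) ℂ) (R : EuclideanSpace ℂ (Fin ein × β))
    (X : Matrix α α ℂ) : Matrix ((δ × Fin eout) × β) ((δ × Fin eout) × β) ℂ :=
  (V ⊗ₖ (1 : Matrix β β ℂ)) *
    (X ⊗ₖ pureState R).submatrix (Equiv.prodAssoc α (Fin ein) β) (Equiv.prodAssoc α (Fin ein) β) *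
    (V ⊗ₖ (1 : Matrix β β ℂ)).conjTranspose

/-- Partial trace over the ancilla output space `E_out`. -/
def traceAncilla (X : Matrix ((δ × Fin eout) × β) ((δ × Fin eout) × β) ℂ) :
    Matrix (δ × β) (δ × β) ℂ :=
  Matrix.of fun p q => ∑ f, X ((p.1, f), p.2) ((q.1, f), q.2)

/-- The vector `(V ⊗ 1_{E'}) (ψ ⊗ |R⟩_{E,E'})`. -/
def applyToAncilla [Fintype α] [Fintype β] [DecidableEq β]
    (V : Matrix (δ × Fin eout) (α × Fin ein) ℂ) (R : EuclideanSpace ℂ (Fin ein × β))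
    (ψ : α → ℂ) : (δ × Fin eout) × β → ℂ :=
  (V ⊗ₖ (1 : Matrix β β ℂ)).mulVec fun p => ψ p.1.1 * R (p.1.2, p.2)

/-- Unitary representation of a map `Λ` on the `N` parties and Bob: an ancilla state `|R⟩` on
`E ⊗ E'`, with `E'` handed to Bob, and a unitary `V` on the inputs and `E` with
`Λ(X) = tr_{E_out} { V (tr_{B_in} X ⊗ |R⟩⟨R|) V† }`; for every ordering `σ` of the parties, `V`
coincides, on all inputs with the ancilla in state `|R⟩`, with a product of unitaries that each act
on one party and the ancilla. -/
def HasUnitaryRep {N d : ℕ} {κ : Fin N → Type*} [∀ j, Fintype (κ j)] [∀ j, DecidableEq (κ j)]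
    {β : Type*} [Fintype β] [DecidableEq β]
    (Λ : Matrix ((∀ j, κ j) × β) ((∀ j, κ j) × β) ℂ →ₗ[ℂ]
      Matrix ((Fin N → Fin d) × β) ((Fin N → Fin d) × β) ℂ) : Prop :=
  ∃ (ein eout : ℕ) (R : EuclideanSpace ℂ (Fin ein × β))
    (V : Matrix ((Fin N → Fin d) × Fin eout) ((∀ j, κ j) × Fin ein) ℂ),
    ‖R‖ = 1 ∧ IsUnitaryOp V ∧
    (∀ X, Λ X = traceAncilla (evolve V R (traceSnd X))) ∧
    ∀ σ : Equiv.Perm (Fin N),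
      ∃ W : Matrix ((Fin N → Fin d) × Fin eout) ((∀ j, κ j) × Fin ein) ℂ,
        IsSequential σ W ∧ ∀ ψ, applyToAncilla V R ψ = applyToAncilla W R ψ

end Representation

end Teleportage

/-!
The argument works with Choi matrices. A map `Λ` that ignores Bob's input is `Φ ∘ tr_B` for a map
`Φ` from the parties to the parties and Bob, and `IsCausalKernel` describes the Choi matrices `C`
of the channels `Φ` for which, for every set `S` of parties, the output of `S` and Bob depends
only on the input of `S`. All three parts reduce to the equivalence between such kernels and
unitary representations, proved in `HasUnitaryRep.exists_causalKernel` and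
`hasUnitaryRep_of_causalKernel`.

From a kernel to a unitary representation: for each set `S` the marginal of `C` on `S` is positive
semidefinite, so it is the Gram matrix of vectors in an ancilla space, which is a Stinespring
dilation of the reduced channel (`dilation`). If one more party `k` acts, then causality says that
the dilation for `S ∪ {k}`, with the output of `k` counted as part of the ancilla, and the
dilation for `S`, with the input of `k` counted as part of the ancilla, have the same Gram matrix.
Two factorizations of one Gram matrix through spaces of equal dimension differ by a unitary
(`exists_unitary_of_gram_eq`), and this is the local unitary of `k` (`exists_unitary_step`). The
ancilla dimensions are chosen so that all these spaces match. The dilation for `S = ∅` is the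
ancilla state `|R⟩`, a purification of Bob's state, and the one for all parties is `V` applied to
`|R⟩`. Neither of them depends on the order in which the parties are added, so every order yields
a factorization of the same `V` on `|R⟩`.

From a unitary representation to a kernel: given `S`, take an order in which the parties in `S`
act first. The later local steps are isometries, so tracing out their outputs turns the inputs of
the later parties into a trace (`marg_amp`), which is causality for `S`.

A non-signalling teleportage gives the kernel of `ρ ↦ ∑ₐ |a⟩⟨a| ⊗ T_a(ρ)`, and a causal channel
with fixed input for Bob gives a kernel because density operators span. Conversely, measuring
product bases on the outputs of a causal kernel gives a non-signalling teleportage, whose reduced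
teleportages come from the same measurement on the marginals (`IsMarginal`).
-/

open scoped Kronecker ComplexOrder

namespace Teleportage

/-! ### Kernels of completely positive maps -/

section Kernels

variable {m n : Type*}

/-- The linear map `X ↦ ∑ x x', X x x' • C_{x x'}` whose Choi matrix is `C`; the first component of
the index of `C` is the input index. -/
def kerMap [Fintype m] (C : Matrix (m × n) (m × n) ℂ) : Matrix m m ℂ →ₗ[ℂ] Matrix n n ℂ where
  toFun X := Matrix.of fun i j => ∑ x, ∑ x', C (x, i) (x', j) * X x x'
  map_add' X Y := by
    ext i j
    simp [mul_add, Finset.sum_add_distrib]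
  map_smul' r X := by
    ext i j
    simp [Finset.mul_sum, mul_left_comm]

lemma kerMap_apply [Fintype m] (C : Matrix (m × n) (m × n) ℂ) (X : Matrix m m ℂ) (i j : n) :
    kerMap C X i j = ∑ x, ∑ x', C (x, i) (x', j) * X x x' := rfl

/-- The Choi matrix of a linear map between matrix algebras. -/
def choi [DecidableEq m] (Φ : Matrix m m ℂ →ₗ[ℂ] Matrix n n ℂ) : Matrix (m × n) (m × n) ℂ :=
  Matrix.of fun a b => Φ (Matrix.single a.1 b.1 1) a.2 b.2

lemma kerMap_choi [Fintype m] [DecidableEq m] (Φ : Matrix m m ℂ →ₗ[ℂ] Matrix n n ℂ) :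
    kerMap (choi Φ) = Φ := by
  refine LinearMap.ext fun X => ?_
  ext i j
  conv_rhs => rw [Matrix.matrix_eq_sum_single X]
  simp only [map_sum, Matrix.sum_apply, kerMap_apply, choi, Matrix.of_apply]
  refine Finset.sum_congr rfl fun x _ => Finset.sum_congr rfl fun y _ => ?_
  have : Matrix.single x y (X x y) = X x y • Matrix.single x y (1 : ℂ) := by simp
  rw [this, map_smul, Matrix.smul_apply, smul_eq_mul, mul_comm]

lemma posSemidef_of_fun_mul_star {r : Type*} [Finite m] [Fintype r] (A : Matrix m r ℂ) :
    (Matrix.of fun i j => ∑ k, A i k * star (A j k) : Matrix m m ℂ).PosSemidef :=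
  Matrix.posSemidef_self_mul_conjTranspose A

/-- Compressing the first tensor factor of a positive semidefinite matrix along a vector leaves a
positive semidefinite matrix. -/
lemma posSemidef_compressFst [Fintype m] [Finite n] {M : Matrix (m × n) (m × n) ℂ}
    (hM : M.PosSemidef) (v : m → ℂ) :
    (Matrix.of fun i j => ∑ x, ∑ x', v x * M (x, i) (x', j) * star (v x') :
      Matrix n n ℂ).PosSemidef := by
  classical
  have := Fintype.ofFinite n
  have h := hM.mul_mul_conjTranspose_same
    (Matrix.of fun (i : n) (p : m × n) => if p.2 = i then v p.1 else 0)
  convert h using 1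
  ext i j
  simp only [Matrix.of_apply, Matrix.mul_apply, Matrix.conjTranspose_apply,
    Fintype.sum_prod_type, ite_mul, zero_mul, Finset.sum_ite_eq', Finset.mem_univ, if_true,
    apply_ite star, star_zero, mul_ite, mul_zero, Finset.sum_mul]
  rw [Finset.sum_comm]

lemma isCP_kerMap [Fintype m] [Fintype n] {C : Matrix (m × n) (m × n) ℂ} (hC : C.PosSemidef) :
    IsCP (kerMap C) := by
  intro k X hX
  have h := posSemidef_compressFst
    ((hC.kronecker hX).submatrix fun a : m × (n × Fin k) => ((a.1, a.2.1), (a.1, a.2.2)))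
    (fun _ => 1)
  convert h using 1
  ext ⟨i, p⟩ ⟨j, q⟩
  simp [ampliation, kerMap_apply]

lemma posSemidef_choi [Fintype m] [DecidableEq m] [Fintype n]
    {Φ : Matrix m m ℂ →ₗ[ℂ] Matrix n n ℂ} (hΦ : IsCP Φ) : (choi Φ).PosSemidef := by
  -- the Choi matrix is the ampliation applied to the maximally entangled vector
  let e := Fintype.equivFin m
  let w : m × Fin (Fintype.card m) → ℂ := fun a => if e a.1 = a.2 then 1 else 0
  have h := (hΦ _ _ (Matrix.posSemidef_vecMulVec_self_star w)).submatrix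
    fun a : m × n => (a.2, e a.1)
  convert h using 1
  ext ⟨x, i⟩ ⟨y, j⟩
  simp only [choi, ampliation, Matrix.of_apply, Matrix.submatrix_apply]
  refine congrArg (fun Z => Φ Z i j) ?_
  ext x' y'
  simp only [w, Matrix.vecMulVec_apply, Matrix.of_apply, EmbeddingLike.apply_eq_iff_eq,
    Pi.star_apply, Matrix.single_apply]
  by_cases h1 : x = x' <;> by_cases h2 : y = y' <;> simp [h1, h2, eq_comm]

/-- A kernel with unit partial traces gives a trace-preserving map. -/
lemma trace_kerMap [Fintype m] [DecidableEq m] [Fintype n] {C : Matrix (m × n) (m × n) ℂ}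
    (hC : ∀ x x', ∑ o, C (x, o) (x', o) = if x = x' then 1 else 0) (X : Matrix m m ℂ) :
    (kerMap C X).trace = X.trace := by
  simp only [Matrix.trace, Matrix.diag_apply, kerMap_apply]
  rw [Finset.sum_comm]
  refine Finset.sum_congr rfl fun x _ => ?_
  rw [Finset.sum_comm]
  simp [← Finset.sum_mul, hC]

lemma isDensity_pureState [Fintype n] {v : EuclideanSpace ℂ n} (hv : ‖v‖ = 1) :
    IsDensity (pureState v) := by
  refine ⟨Matrix.posSemidef_vecMulVec_self_star _, ?_⟩
  have h := EuclideanSpace.norm_sq_eq v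
  rw [hv] at h
  have h2 : ((∑ i, ‖v i‖ ^ 2 : ℝ) : ℂ) = 1 := by rw [← h]; simp
  rw [← h2]
  simp [Matrix.trace, pureState, Complex.mul_conj, Complex.normSq_eq_norm_sq]

/-- Two linear maps that agree on density operators agree everywhere: by polarization the density
operators span. -/
lemma eq_of_eq_on_density {F : Type*} [Fintype n] [AddCommGroup F] [Module ℂ F]
    {f g : Matrix n n ℂ →ₗ[ℂ] F} (h : ∀ ρ, IsDensity ρ → f ρ = g ρ) : f = g := by
  classical
  have hpsd : ∀ P : Matrix n n ℂ, P.PosSemidef → f P = g P := by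
    intro P hP
    by_cases h0 : P.trace = 0
    · rw [hP.trace_eq_zero_iff.mp h0, map_zero, map_zero]
    · have hd : IsDensity (P.trace⁻¹ • P) :=
        ⟨hP.smul (inv_nonneg.mpr hP.trace_nonneg), by simp [Matrix.trace_smul, h0]⟩
      have := h _ hd
      rw [map_smul, map_smul] at this
      exact smul_right_injective F (inv_ne_zero h0) this
  have hv : ∀ v : n → ℂ, f (Matrix.vecMulVec v (star v)) = g (Matrix.vecMulVec v (star v)) :=
    fun v => hpsd _ (Matrix.posSemidef_vecMulVec_self_star v)
  refine LinearMap.ext fun X => ?_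
  rw [Matrix.matrix_eq_sum_single X]
  simp only [map_sum]
  refine Finset.sum_congr rfl fun i _ => Finset.sum_congr rfl fun j _ => ?_
  let u : ℂ → n → ℂ := fun z => Pi.single i 1 + z • Pi.single j 1
  have key : Matrix.single i j (X i j) = (X i j / 4) •
      (Matrix.vecMulVec (u 1) (star (u 1)) - Matrix.vecMulVec (u (-1)) (star (u (-1)))
        + Complex.I • (Matrix.vecMulVec (u Complex.I) (star (u Complex.I))
          - Matrix.vecMulVec (u (-Complex.I)) (star (u (-Complex.I))))) := by
    ext a b
    have hs : Matrix.single i j (X i j) a b =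
        X i j * (Pi.single i 1 : n → ℂ) a * (Pi.single j 1 : n → ℂ) b := by
      simp only [Matrix.single_apply, Pi.single_apply, eq_comm (a := a), eq_comm (a := b)]
      by_cases h1 : i = a <;> by_cases h2 : j = b <;> simp [h1, h2]
    have hstar : ∀ k l : n, star ((Pi.single k 1 : n → ℂ) l) = (Pi.single k 1 : n → ℂ) l := by
      intro k l
      by_cases h : l = k <;> simp [h]
    rw [hs]
    simp only [u, Matrix.smul_apply, Matrix.add_apply, Matrix.sub_apply, Matrix.vecMulVec_apply,
      Pi.add_apply, Pi.smul_apply, Pi.star_apply, smul_eq_mul, star_add, star_mul', hstar,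
      star_one, star_neg, Complex.star_def, Complex.conj_I]
    linear_combination (X i j / 2 * ((Pi.single i 1 : n → ℂ) a * (Pi.single j 1 : n → ℂ) b -
      (Pi.single j 1 : n → ℂ) a * (Pi.single i 1 : n → ℂ) b)) * Complex.I_mul_I
  rw [key]
  simp only [map_smul, map_add, map_sub, hv]

/-- A positive semidefinite matrix is a Gram matrix of vectors in any space of sufficiently large
dimension. -/
lemma exists_factor [Fintype m] {M : Matrix m m ℂ} (hM : M.PosSemidef) {e : ℕ}
    (he : Fintype.card m ≤ e) :
    ∃ A : Matrix m (Fin e) ℂ, M = A * A.conjTranspose := by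
  classical
  open scoped MatrixOrder in
  obtain ⟨B, hB⟩ := CStarAlgebra.nonneg_iff_eq_star_mul_self.mp hM.nonneg
  obtain ⟨g⟩ := Function.Embedding.nonempty_of_card_le
    (by simpa using he : Fintype.card m ≤ Fintype.card (Fin e))
  let J : Matrix m (Fin e) ℂ := Matrix.of fun i f => if g i = f then 1 else 0
  have hJ : J * J.conjTranspose = 1 := by
    ext i j
    simp [J, Matrix.mul_apply, Matrix.one_apply, eq_comm]
  refine ⟨B.conjTranspose * J, ?_⟩
  rw [Matrix.conjTranspose_mul, Matrix.conjTranspose_conjTranspose, Matrix.mul_assoc,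
    ← Matrix.mul_assoc J, hJ, Matrix.one_mul, hB]
  rfl

/-- A chosen factor `A` with `M = A Aᴴ` and `e` columns; the zero matrix if there is none. -/
noncomputable def factor (M : Matrix m m ℂ) (e : ℕ) : Matrix m (Fin e) ℂ :=
  open Classical in
  if h : ∃ A : Matrix m (Fin e) ℂ, M = A * A.conjTranspose then h.choose else 0

lemma factor_spec [Fintype m] {M : Matrix m m ℂ} (hM : M.PosSemidef) {e : ℕ}
    (he : Fintype.card m ≤ e) (i j : m) :
    ∑ k, factor M e i k * star (factor M e j k) = M i j := by
  have h := exists_factor hM he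
  have h2 : factor M e * (factor M e).conjTranspose = M := by
    rw [factor, dif_pos h]
    exact h.choose_spec.symm
  conv_rhs => rw [← h2]
  simp [Matrix.mul_apply]

/-- Sending the combination of the rows of `A` with coefficients `c` to that of the rows of `B`
preserves norms, so it is a well-defined isometry on the row space of `A` and extends to a
unitary. -/
lemma exists_unitary_square [Fintype m] [Fintype n] [DecidableEq n] {A B : Matrix m n ℂ}
    (h : A * A.conjTranspose = B * B.conjTranspose) :
    ∃ U : Matrix n n ℂ, IsUnitaryOp U ∧ ∀ i k', B i k' = ∑ k, U k' k * A i k := by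
  let F : Matrix m n ℂ → ((m → ℂ) →ₗ[ℂ] EuclideanSpace ℂ n) := fun A =>
    (WithLp.linearEquiv 2 ℂ (n → ℂ)).symm.toLinearMap ∘ₗ A.vecMulLinear
  have hF : ∀ A c k, F A c k = ∑ i, c i * A i k := fun A c k => rfl
  have hFin : ∀ A c, inner ℂ (F A c) (F A c) =
      ∑ i, ∑ j, c i * star (c j) * (A * A.conjTranspose) i j := by
    intro A c
    simp only [PiLp.inner_apply, RCLike.inner_apply, hF, Matrix.mul_apply, map_sum, map_mul,
      Matrix.conjTranspose_apply, Finset.mul_sum, Finset.sum_mul]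
    rw [Finset.sum_comm]
    conv_lhs => enter [2, j]; rw [Finset.sum_comm]
    rw [Finset.sum_comm]
    refine Finset.sum_congr rfl fun i _ => Finset.sum_congr rfl fun j _ =>
      Finset.sum_congr rfl fun k _ => ?_
    simp only [RCLike.star_def]
    ring
  have hnorm : ∀ c, ‖F A c‖ = ‖F B c‖ := by
    intro c
    have h1 : inner ℂ (F A c) (F A c) = inner ℂ (F B c) (F B c) := by rw [hFin, hFin, h]
    rw [inner_self_eq_norm_sq_to_K, inner_self_eq_norm_sq_to_K] at h1
    have h2 : ‖F A c‖ ^ 2 = ‖F B c‖ ^ 2 := by exact_mod_cast h1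
    exact (sq_eq_sq₀ (norm_nonneg _) (norm_nonneg _)).mp h2
  obtain ⟨s, hs⟩ := (F A).rangeRestrict.exists_rightInverse_of_surjective
    (LinearMap.range_eq_top.mpr (F A).surjective_rangeRestrict)
  have hs' : ∀ y, F A (s y) = y := fun y => congrArg Subtype.val (LinearMap.congr_fun hs y)
  let L : LinearMap.range (F A) →ₗᵢ[ℂ] EuclideanSpace ℂ n :=
    { toLinearMap := F B ∘ₗ s
      norm_map' := fun y => by
        change ‖F B (s y)‖ = ‖y‖
        rw [← hnorm, hs']
        rfl }
  have hL : ∀ c, L.extend (F A c) = F B c := by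
    intro c
    have h1 := L.extend_apply ⟨F A c, c, rfl⟩
    have h2 : F A (s ⟨F A c, c, rfl⟩ - c) = 0 := by rw [map_sub, hs', sub_self]
    have h3 : F B (s ⟨F A c, c, rfl⟩ - c) = 0 := by
      rw [← norm_eq_zero, ← hnorm, h2, norm_zero]
    rw [map_sub, sub_eq_zero] at h3
    exact h1.trans h3
  let U : Matrix n n ℂ := Matrix.of fun k' k => L.extend (EuclideanSpace.single k 1) k'
  have hU : U.conjTranspose * U = 1 := by
    ext k l
    have := L.extend.inner_map_map (EuclideanSpace.single k 1) (EuclideanSpace.single l 1)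
    rw [PiLp.inner_apply] at this
    simp only [RCLike.inner_apply, EuclideanSpace.inner_single_left, map_one, one_mul] at this
    simp only [Matrix.mul_apply, Matrix.conjTranspose_apply, U, Matrix.of_apply, Matrix.one_apply]
    rw [← RCLike.star_def] at this
    simp only [mul_comm] at this ⊢
    rw [this]
    simp [PiLp.single_apply]
  refine ⟨U, ⟨hU, mul_eq_one_comm.mp hU⟩, fun i k' => ?_⟩
  classical
  have h1 : F A (Pi.single i 1) = ∑ k, A i k • EuclideanSpace.single k (1 : ℂ) := by
    ext k
    simp [hF, Pi.single_apply]
  have h2 := hL (Pi.single i 1)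
  rw [h1] at h2
  have h3 := congrArg (fun v => v k') h2
  simp only [hF, map_sum, map_smul] at h3
  simp only [Pi.single_apply, ite_mul, one_mul, zero_mul, Finset.sum_ite_eq', Finset.mem_univ,
    if_true] at h3
  rw [← h3]
  simp [U, mul_comm]

/-- Unitary freedom of Gram factorizations: if `A Aᴴ = B Bᴴ` and the two ancilla spaces have the
same dimension, then a unitary between them carries the rows of `A` to the rows of `B`. -/
lemma exists_unitary_of_gram_eq {r s : Type*} [Fintype m] [Fintype r] [DecidableEq r] [Fintype s]
    [DecidableEq s] (hcard : Fintype.card r = Fintype.card s) (A : m → s → ℂ) (B : m → r → ℂ)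
    (h : ∀ i j, ∑ k, A i k * star (A j k) = ∑ k, B i k * star (B j k)) :
    ∃ U : Matrix r s ℂ, IsUnitaryOp U ∧ ∀ i k', B i k' = ∑ k, U k' k * A i k := by
  let e := Fintype.equivOfCardEq hcard
  obtain ⟨U, ⟨hU1, hU2⟩, hB⟩ := exists_unitary_square (A := (Matrix.of A))
    (B := (Matrix.of B).submatrix id e.symm) (by
      ext i j
      simp only [Matrix.mul_apply, Matrix.conjTranspose_apply, Matrix.of_apply,
        Matrix.submatrix_apply, id, h]
      exact (Equiv.sum_comp e.symm fun k => B i k * star (B j k)).symm)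
  refine ⟨U.submatrix e id, ⟨?_, ?_⟩, fun i k' => ?_⟩
  · rw [Matrix.conjTranspose_submatrix, Matrix.submatrix_mul_equiv, hU1]
    simp
  · rw [Matrix.conjTranspose_submatrix]
    have := Matrix.submatrix_mul_equiv U U.conjTranspose e (Equiv.refl s) e
    simp only [Equiv.coe_refl] at this
    rw [this, hU2, Matrix.submatrix_one_equiv]
  · have := hB i (e k')
    simpa using this

end Kernels
/-! ### Causal kernels -/

section CausalKernels

variable {ι : Type*} [DecidableEq ι] {κ : ι → Type*} {d : ℕ} {β : Type*}
variable {X₁ X₂ Y₁ Y₂ : Type*}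

/-- The kernel obtained from `C` by tracing out the outputs of the parties outside `S`. To avoid
restricting functions to `S`, it stays indexed by full configurations; the entries do not depend on
the outputs outside `S`. -/
def marg [Fintype ι] (S : Finset ι)
    (C : Matrix ((∀ j, κ j) × ((ι → Fin d) × β)) ((∀ j, κ j) × ((ι → Fin d) × β)) ℂ) :
    Matrix ((∀ j, κ j) × ((ι → Fin d) × β)) ((∀ j, κ j) × ((ι → Fin d) × β)) ℂ :=
  Matrix.of fun p q => ∑ w : ι → Fin d with ∀ j ∈ S, w j = p.2.1 j,
    C (p.1, (w, p.2.2)) (q.1, (S.piecewise q.2.1 w, q.2.2))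

/-- Choi matrices of the channels from the parties to the parties and Bob for which, for every set
`S` of parties, the joint output of `S` and Bob depends only on the input of `S`: the marginal on
`S` acts on the inputs outside `S` as the trace. -/
structure IsCausalKernel [Fintype ι] [∀ j, DecidableEq (κ j)] [Fintype β]
    (C : Matrix ((∀ j, κ j) × ((ι → Fin d) × β)) ((∀ j, κ j) × ((ι → Fin d) × β)) ℂ) :
    Prop where
  posSemidef : C.PosSemidef
  unitTrace : ∀ x x', ∑ o, C (x, o) (x', o) = if x = x' then 1 else 0
  causal : ∀ (S : Finset ι) (x x' z : ∀ j, κ j) (y y' : ι → Fin d) (b b' : β),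
    ((∀ j ∉ S, x j = x' j) → marg S C (x, (y, b)) (x', (y', b')) =
      marg S C (S.piecewise x z, (y, b)) (S.piecewise x' z, (y', b'))) ∧
    ((¬ ∀ j ∉ S, x j = x' j) → marg S C (x, (y, b)) (x', (y', b')) = 0)

/-- The bijection `g` splits configurations into a first part, which is the configuration of the
parties in `S`, and a second part, which is the configuration of the others. -/
structure Splits (S : Finset ι) (g : X₁ × X₂ ≃ ∀ j, κ j) : Prop where
  fst : ∀ u v v', ∀ j ∈ S, g (u, v) j = g (u, v') j
  snd : ∀ u u' v, ∀ j ∉ S, g (u, v) j = g (u', v) j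

/-- `glue` as a bijection. -/
def glueEquiv (κ : ι → Type*) (S : Finset ι) :
    (∀ j : {j // j ∈ S}, κ j) × (∀ j : {j // j ∉ S}, κ j) ≃ ∀ j, κ j where
  toFun p := glue S p.1 p.2
  invFun x := (fun j => x j, fun j => x j)
  left_inv p := by
    refine Prod.ext (funext fun j => ?_) (funext fun j => ?_)
    · simp [glue, j.2]
    · simp [glue, j.2]
  right_inv x := by
    funext j
    by_cases h : j ∈ S <;> simp [glue, h]

lemma splits_glueEquiv (S : Finset ι) : Splits S (glueEquiv κ S) where
  fst u v v' j hj := by simp [glueEquiv, glue, hj]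
  snd u u' v j hj := by simp [glueEquiv, glue, hj]

/-- `glue` as a bijection, with the parties outside `S` first. -/
def glueEquivCompl (κ : ι → Type*) (S : Finset ι) :
    (∀ j : {j // j ∉ S}, κ j) × (∀ j : {j // j ∈ S}, κ j) ≃ ∀ j, κ j :=
  (Equiv.prodComm _ _).trans (glueEquiv κ S)

lemma splits_glueEquivCompl [Fintype ι] (S : Finset ι) : Splits Sᶜ (glueEquivCompl κ S) where
  fst u v v' j hj := (splits_glueEquiv S).snd v v' u j (by simpa using hj)
  snd u u' v j hj := (splits_glueEquiv S).fst v u u' j (by simpa using hj)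

namespace Splits

variable {S : Finset ι} {g : X₁ × X₂ ≃ ∀ j, κ j}

lemma piecewise_eq (hg : Splits S g) (u u' : X₁) (v v' : X₂) :
    S.piecewise (g (u, v)) (g (u', v')) = g (u, v') := by
  funext j
  by_cases hj : j ∈ S
  · rw [Finset.piecewise_eq_of_mem _ _ _ hj, hg.fst u v v' j hj]
  · rw [Finset.piecewise_eq_of_notMem _ _ _ hj, hg.snd u' u v' j hj]

lemma agree_iff (hg : Splits S g) (u u' : X₁) (v v' : X₂) :
    (∀ j ∉ S, g (u, v) j = g (u', v') j) ↔ v = v' := by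
  constructor
  · intro h
    have : g (u, v) = g (u, v') := by
      funext j
      by_cases hj : j ∈ S
      · exact hg.fst u v v' j hj
      · rw [h j hj, hg.snd u' u v' j hj]
    simpa using this
  · rintro rfl j hj
    exact hg.snd u u' v j hj

/-- Summing over all configurations with prescribed values on `S` is summing over the second
part. -/
lemma filter_sum [Fintype ι] [Fintype X₂] {M : Type*} [AddCommMonoid M] {g : X₁ × X₂ ≃ (ι → Fin d)}
    (hg : Splits S g) (u : X₁) (v : X₂)
    (F : (ι → Fin d) → M) :
    ∑ w : ι → Fin d with ∀ j ∈ S, w j = g (u, v) j, F w = ∑ v', F (g (u, v')) := by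
  refine Finset.sum_nbij' (fun w => (g.symm w).2) (fun v' => g (u, v')) (by simp) ?_ ?_ (by simp) ?_
  · intro v' _
    simpa using hg.fst u v' v
  all_goals
    intro w hw
    have hw' : w = g (u, (g.symm w).2) := by
      have h1 := hg.piecewise_eq u (g.symm w).1 v (g.symm w).2
      rw [← h1]
      simp only [Prod.mk.eta, Equiv.apply_symm_apply]
      funext j
      by_cases hj : j ∈ S
      · rw [Finset.piecewise_eq_of_mem _ _ _ hj]
        exact (Finset.mem_filter.mp hw).2 j hj
      · rw [Finset.piecewise_eq_of_notMem _ _ _ hj]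
  · exact hw'.symm
  · exact congrArg F hw'

end Splits

lemma marg_apply_split [Fintype ι] [Fintype Y₂] {S : Finset ι} {g : Y₁ × Y₂ ≃ (ι → Fin d)}
    (hg : Splits S g)
    (C : Matrix ((∀ j, κ j) × ((ι → Fin d) × β)) ((∀ j, κ j) × ((ι → Fin d) × β)) ℂ)
    (x x' : ∀ j, κ j) (b b' : β) (o o' : Y₁) (w w' : Y₂) :
    marg S C (x, (g (o, w), b)) (x', (g (o', w'), b')) =
      ∑ v, C (x, (g (o, v), b)) (x', (g (o', v), b')) := by
  simp only [marg, Matrix.of_apply]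
  rw [hg.filter_sum]
  simp only [hg.piecewise_eq]

lemma posSemidef_marg [Fintype ι] (S : Finset ι)
    {C : Matrix ((∀ j, κ j) × ((ι → Fin d) × β)) ((∀ j, κ j) × ((ι → Fin d) × β)) ℂ}
    (hC : C.PosSemidef) : (marg S C).PosSemidef := by
  let g := glueEquiv (fun _ : ι => Fin d) S
  have h : marg S C = ∑ v, C.submatrix
      (fun p => (p.1, (g ((g.symm p.2.1).1, v), p.2.2)))
      (fun p => (p.1, (g ((g.symm p.2.1).1, v), p.2.2))) := by
    ext ⟨x, y, b⟩ ⟨x', y', b'⟩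
    have := marg_apply_split (splits_glueEquiv S) C x x' b b' (g.symm y).1 (g.symm y').1
      (g.symm y).2 (g.symm y').2
    simpa [g, Matrix.sum_apply] using this
  rw [h]
  exact Matrix.posSemidef_sum _ fun v _ => hC.submatrix _

lemma marg_univ [Fintype ι]
    (C : Matrix ((∀ j, κ j) × ((ι → Fin d) × β)) ((∀ j, κ j) × ((ι → Fin d) × β)) ℂ) :
    marg Finset.univ C = C := by
  ext ⟨x, y, b⟩ ⟨x', y', b'⟩
  have : (Finset.univ.filter fun w : ι → Fin d => ∀ j ∈ Finset.univ, w j = y j) = {y} := by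
    ext w
    simp [funext_iff]
  simp only [marg, Matrix.of_apply]
  rw [this]
  simp

lemma marg_empty_apply [Fintype ι]
    (C : Matrix ((∀ j, κ j) × ((ι → Fin d) × β)) ((∀ j, κ j) × ((ι → Fin d) × β)) ℂ)
    (x x' : ∀ j, κ j) (y y' : ι → Fin d) (b b' : β) :
    marg ∅ C (x, (y, b)) (x', (y', b')) = ∑ w, C (x, (w, b)) (x', (w, b')) := by
  simp [marg]

/-- Tracing out the outputs of one more party. -/
lemma marg_eq_sum_insert [Fintype ι] {S : Finset ι} {k : ι} (hk : k ∉ S)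
    (C : Matrix ((∀ j, κ j) × ((ι → Fin d) × β)) ((∀ j, κ j) × ((ι → Fin d) × β)) ℂ)
    (x x' : ∀ j, κ j) (y y' : ι → Fin d) (b b' : β) :
    marg S C (x, (y, b)) (x', (y', b')) =
      ∑ v, marg (insert k S) C (x, (Function.update y k v, b))
        (x', (Function.update y' k v, b')) := by
  simp only [marg, Matrix.of_apply]
  rw [← Finset.sum_fiberwise _ (fun w : ι → Fin d => w k)]
  refine Finset.sum_congr rfl fun v _ => ?_
  have hne : ∀ j ∈ S, j ≠ k := fun j hj h => hk (h ▸ hj)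
  refine Finset.sum_congr ?_ fun w hw => ?_
  · ext w
    simp only [Finset.mem_filter, Finset.mem_univ, true_and, Finset.mem_insert,
      forall_eq_or_imp, Function.update_self]
    rw [and_comm]
    refine and_congr_right fun _ => forall₂_congr fun j hj => ?_
    rw [Function.update_of_ne (hne j hj)]
  · have hv : w k = v := by
      have := (Finset.mem_filter.mp hw).2 k (Finset.mem_insert_self k S)
      simpa using this
    congr 3
    funext j
    by_cases hj : j ∈ S
    · simp [hj, Function.update_of_ne (hne j hj)]
    · by_cases hjk : j = k
      · subst hjk
        simp [hj, hv]
      · simp [hj, hjk]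

/-- The marginal on `S` ignores the outputs outside `S`. -/
lemma marg_piecewise [Fintype ι] (S : Finset ι)
    (C : Matrix ((∀ j, κ j) × ((ι → Fin d) × β)) ((∀ j, κ j) × ((ι → Fin d) × β)) ℂ)
    (x x' : ∀ j, κ j) (y y' z z' : ι → Fin d) (b b' : β) :
    marg S C (x, (S.piecewise y z, b)) (x', (S.piecewise y' z', b')) =
      marg S C (x, (y, b)) (x', (y', b')) := by
  simp only [marg, Matrix.of_apply]
  refine Finset.sum_congr ?_ fun w _ => ?_
  · ext w
    simp only [Finset.mem_filter, Finset.mem_univ, true_and]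
    exact forall₂_congr fun j hj => by rw [Finset.piecewise_eq_of_mem _ _ _ hj]
  · congr 3
    funext j
    by_cases hj : j ∈ S <;> simp [hj]

/-- `D` is the kernel that `C` induces from the first parts of the inputs to the first parts of the
outputs and Bob: tracing out the second parts of the outputs turns the second parts of the inputs
into a trace. -/
def IsMarginal {X Y : Type*} [Fintype Y₂] [DecidableEq X₂] (gX : X₁ × X₂ ≃ X) (gY : Y₁ × Y₂ ≃ Y)
    (C : Matrix (X × (Y × β)) (X × (Y × β)) ℂ)
    (D : Matrix (X₁ × (Y₁ × β)) (X₁ × (Y₁ × β)) ℂ) : Prop :=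
  ∀ u u' v v' o o' b b', ∑ w, C (gX (u, v), (gY (o, w), b)) (gX (u', v'), (gY (o', w), b')) =
    if v = v' then D (u, (o, b)) (u', (o', b')) else 0

lemma IsCausalKernel.exists_isMarginal [Fintype ι] [∀ j, DecidableEq (κ j)] [Fintype β]
    [Fintype Y₂] [DecidableEq X₂] [Nonempty X₂]
    {C : Matrix ((∀ j, κ j) × ((ι → Fin d) × β)) ((∀ j, κ j) × ((ι → Fin d) × β)) ℂ}
    (hC : IsCausalKernel C) {S : Finset ι} {gX : X₁ × X₂ ≃ ∀ j, κ j}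
    {gY : Y₁ × Y₂ ≃ (ι → Fin d)} (hX : Splits S gX) (hY : Splits S gY) :
    ∃ D, IsMarginal gX gY C D := by
  obtain ⟨z⟩ := ‹Nonempty X₂›
  refine ⟨Matrix.of fun p q => ∑ w, C (gX (p.1, z), (gY (p.2.1, w), p.2.2))
    (gX (q.1, z), (gY (q.2.1, w), q.2.2)), fun u u' v v' o o' b b' => ?_⟩
  rcases isEmpty_or_nonempty Y₂ with hE | ⟨⟨w⟩⟩
  · simp
  simp only [Matrix.of_apply]
  rw [← marg_apply_split hY C _ _ b b' o o' w w, ← marg_apply_split hY C _ _ b b' o o' w w]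
  have h := hC.causal S (gX (u, v)) (gX (u', v')) (gX (u, z)) (gY (o, w)) (gY (o', w)) b b'
  rw [hX.agree_iff, hX.piecewise_eq, hX.piecewise_eq] at h
  split_ifs with hv
  · exact h.1 hv
  · exact h.2 hv

/-- A marginal on the parties in `S` witnesses that the parties outside `S` do not signal to `S`
and Bob. -/
lemma causal_of_isMarginal [Fintype ι] [Fintype Y₂] [DecidableEq X₂]
    {C : Matrix ((∀ j, κ j) × ((ι → Fin d) × β)) ((∀ j, κ j) × ((ι → Fin d) × β)) ℂ}
    {S : Finset ι} {gX : X₁ × X₂ ≃ ∀ j, κ j}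
    {gY : Y₁ × Y₂ ≃ (ι → Fin d)} (hX : Splits S gX) (hY : Splits S gY)
    {D : Matrix (X₁ × (Y₁ × β)) (X₁ × (Y₁ × β)) ℂ} (hD : IsMarginal gX gY C D)
    (x x' z : ∀ j, κ j) (y y' : ι → Fin d) (b b' : β) :
    ((∀ j ∉ S, x j = x' j) → marg S C (x, (y, b)) (x', (y', b')) =
      marg S C (S.piecewise x z, (y, b)) (S.piecewise x' z, (y', b'))) ∧
    ((¬ ∀ j ∉ S, x j = x' j) → marg S C (x, (y, b)) (x', (y', b')) = 0) := by
  obtain ⟨⟨u, v⟩, rfl⟩ := gX.surjective x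
  obtain ⟨⟨u', v'⟩, rfl⟩ := gX.surjective x'
  obtain ⟨⟨u₀, v₀⟩, rfl⟩ := gX.surjective z
  obtain ⟨⟨o, w⟩, rfl⟩ := gY.surjective y
  obtain ⟨⟨o', w'⟩, rfl⟩ := gY.surjective y'
  rw [hX.agree_iff, hX.piecewise_eq, hX.piecewise_eq, marg_apply_split hY, marg_apply_split hY,
    hD, hD, if_pos rfl]
  exact ⟨fun h => if_pos h, fun h => if_neg h⟩

/-- The partial trace over the second part of a split system. -/
def traceSecond {X : Type*} [Fintype X₂] (g : X₁ × X₂ ≃ X) (ρ : Matrix X X ℂ) : Matrix X₁ X₁ ℂ :=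
  Matrix.of fun u u' => ∑ v, ρ (g (u, v)) (g (u', v))

namespace IsMarginal

variable {X Y : Type*} [Fintype Y₂] [DecidableEq X₂] {gX : X₁ × X₂ ≃ X} {gY : Y₁ × Y₂ ≃ Y}
  {C : Matrix (X × (Y × β)) (X × (Y × β)) ℂ} {D : Matrix (X₁ × (Y₁ × β)) (X₁ × (Y₁ × β)) ℂ}

lemma apply (hD : IsMarginal gX gY C D) (z : X₂) (u u' : X₁) (o o' : Y₁) (b b' : β) :
    D (u, (o, b)) (u', (o', b')) =
      ∑ w, C (gX (u, z), (gY (o, w), b)) (gX (u', z), (gY (o', w), b')) := by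
  rw [hD, if_pos rfl]

lemma posSemidef [Nonempty X₂] (hD : IsMarginal gX gY C D) (hC : C.PosSemidef) :
    D.PosSemidef := by
  obtain ⟨z⟩ := ‹Nonempty X₂›
  have h : D = ∑ w, C.submatrix (fun p => (gX (p.1, z), (gY (p.2.1, w), p.2.2)))
      (fun p => (gX (p.1, z), (gY (p.2.1, w), p.2.2))) := by
    ext ⟨u, o, b⟩ ⟨u', o', b'⟩
    simp [hD.apply z, Matrix.sum_apply]
  rw [h]
  exact Matrix.posSemidef_sum _ fun v _ => hC.submatrix _

/-- Tracing out all outputs of the marginal is the same as tracing out all outputs of `C`. -/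
lemma sum_outputs [Nonempty X₂] [Fintype Y] [Fintype Y₁] [DecidableEq X] [DecidableEq X₁]
    (hD : IsMarginal gX gY C D) {ρ : Matrix β β ℂ} {b b' : β}
    (hC : ∀ x x', ∑ y, C (x, (y, b)) (x', (y, b')) = if x = x' then ρ b b' else 0) (u u' : X₁) :
    ∑ o, D (u, (o, b)) (u', (o, b')) = if u = u' then ρ b b' else 0 := by
  obtain ⟨z⟩ := ‹Nonempty X₂›
  simp_rw [hD.apply z]
  rw [← Fintype.sum_prod_type', gY.sum_comp (fun y => C (gX (u, z), (y, b)) (gX (u', z), (y, b'))),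
    hC]
  simp

lemma unitTrace [Nonempty X₂] [Fintype Y] [Fintype Y₁] [DecidableEq X] [DecidableEq X₁]
    [Fintype β] (hD : IsMarginal gX gY C D)
    (hC : ∀ x x', ∑ o, C (x, o) (x', o) = if x = x' then 1 else 0) (u u' : X₁) :
    ∑ o, D (u, o) (u', o) = if u = u' then 1 else 0 := by
  obtain ⟨z⟩ := ‹Nonempty X₂›
  rw [Fintype.sum_prod_type_right]
  simp_rw [hD.apply z]
  have h : ∀ b : β, (∑ o, ∑ w, C (gX (u, z), (gY (o, w), b)) (gX (u', z), (gY (o, w), b))) =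
      ∑ y, C (gX (u, z), (y, b)) (gX (u', z), (y, b)) := fun b => by
    rw [← Fintype.sum_prod_type',
      gY.sum_comp (fun y => C (gX (u, z), (y, b)) (gX (u', z), (y, b)))]
  simp_rw [h]
  rw [← Fintype.sum_prod_type_right (fun o : Y × β => C (gX (u, z), o) (gX (u', z), o)), hC]
  simp

/-- Discarding the second part of the output of `kerMap C` amounts to discarding the second part of
the input and applying `kerMap D`. -/
lemma kerMap_apply [Fintype X] [Fintype X₁] [Fintype X₂] (hD : IsMarginal gX gY C D)
    (ρ : Matrix X X ℂ) (o o' : Y₁) (b b' : β) :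
    ∑ w, kerMap C ρ (gY (o, w), b) (gY (o', w), b') =
      kerMap D (traceSecond gX ρ) (o, b) (o', b') := by
  simp only [Teleportage.kerMap_apply, traceSecond, Matrix.of_apply]
  have h : ∀ F : X → ℂ, ∑ x, F x = ∑ u, ∑ v, F (gX (u, v)) := fun F => by
    rw [← Fintype.sum_prod_type', gX.sum_comp]
  rw [Finset.sum_comm]
  simp_rw [Finset.sum_comm (s := (Finset.univ : Finset Y₂)), ← Finset.sum_mul, h, hD _ _ _ _]
  refine Finset.sum_congr rfl fun u _ => ?_
  rw [Finset.sum_comm]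
  refine Finset.sum_congr rfl fun u' _ => ?_
  simp [Finset.mul_sum]

end IsMarginal

end CausalKernels
/-! ### The kernel of a unitary representation -/

section RepKernel

variable {α δ β : Type*} {ein eout : ℕ}

/-- The amplitude `⟨y, f, b| (V ⊗ 1) (|x⟩ ⊗ |R⟩)`. -/
def repAmp (V : Matrix (δ × Fin eout) (α × Fin ein) ℂ) (R : EuclideanSpace ℂ (Fin ein × β))
    (x : α) (y : δ) (b : β) (f : Fin eout) : ℂ :=
  ∑ e, V (y, f) (x, e) * R (e, b)

/-- The Choi matrix of `X ↦ tr_{E_out} {V (X ⊗ |R⟩⟨R|) V†}`. -/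
def repKernel (V : Matrix (δ × Fin eout) (α × Fin ein) ℂ) (R : EuclideanSpace ℂ (Fin ein × β)) :
    Matrix (α × (δ × β)) (α × (δ × β)) ℂ :=
  Matrix.of fun p q => ∑ f, repAmp V R p.1 p.2.1 p.2.2 f * star (repAmp V R q.1 q.2.1 q.2.2 f)


lemma applyToAncilla_apply [Fintype α] [Fintype β] [DecidableEq β]
    (V : Matrix (δ × Fin eout) (α × Fin ein) ℂ)
    (R : EuclideanSpace ℂ (Fin ein × β)) (ψ : α → ℂ) (y : δ) (f : Fin eout) (b : β) :
    applyToAncilla V R ψ ((y, f), b) = ∑ x, ψ x * repAmp V R x y b f := by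
  simp only [applyToAncilla, Matrix.mulVec, dotProduct, Fintype.sum_prod_type,
    Matrix.kroneckerMap_apply, Matrix.one_apply, repAmp, Finset.mul_sum]
  refine Finset.sum_congr rfl fun x _ => Finset.sum_congr rfl fun e _ => ?_
  simp only [mul_ite, mul_one, mul_zero, ite_mul, zero_mul, Finset.sum_ite_eq, Finset.mem_univ,
    if_true]
  ring

lemma traceAncilla_evolve [Fintype α] [Fintype β] [DecidableEq β]
    (V : Matrix (δ × Fin eout) (α × Fin ein) ℂ)
    (R : EuclideanSpace ℂ (Fin ein × β)) (X : Matrix α α ℂ) :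
    traceAncilla (evolve V R X) = kerMap (repKernel V R) X := by
  ext ⟨y, b⟩ ⟨y', b'⟩
  have h : ∀ f, evolve V R X ((y, f), b) ((y', f), b') =
      ∑ x, ∑ x', repAmp V R x y b f * star (repAmp V R x' y' b' f) * X x x' := by
    intro f
    simp only [evolve, Matrix.mul_apply, Fintype.sum_prod_type, Matrix.kroneckerMap_apply,
      Matrix.conjTranspose_apply, Matrix.submatrix_apply, Equiv.prodAssoc_apply, pureState,
      Matrix.of_apply, Matrix.one_apply, mul_ite, mul_one, mul_zero, ite_mul, zero_mul,
      Finset.sum_ite_eq, Finset.mem_univ, if_true, apply_ite star, star_zero]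
    simp only [repAmp, star_sum, Finset.sum_mul, Finset.mul_sum, star_mul']
    conv_lhs => enter [2, x']; rw [Finset.sum_comm]
    rw [Finset.sum_comm]
    refine Finset.sum_congr rfl fun x _ => Finset.sum_congr rfl fun x' _ =>
      Finset.sum_congr rfl fun e' _ => Finset.sum_congr rfl fun e _ => ?_
    ring
  simp only [traceAncilla, Matrix.of_apply, h, kerMap_apply, repKernel, Finset.sum_mul]
  rw [Finset.sum_comm]
  refine Finset.sum_congr rfl fun x _ => ?_
  rw [Finset.sum_comm]

/-- The kernel of a unitary representation belongs to a trace-preserving map. -/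
lemma repKernel_unitTrace [Fintype β] [Fintype δ] [DecidableEq α] [DecidableEq δ]
    {V : Matrix (δ × Fin eout) (α × Fin ein) ℂ} (hV : V.conjTranspose * V = 1)
    {R : EuclideanSpace ℂ (Fin ein × β)} (hR : ‖R‖ = 1) (x x' : α) :
    ∑ o, repKernel V R (x, o) (x', o) = if x = x' then 1 else 0 := by
  have hV' : ∀ p q, ∑ r, V r p * star (V r q) = if p = q then 1 else 0 := by
    intro p q
    have := congrFun (congrFun hV q) p
    rw [Matrix.mul_apply, Matrix.one_apply] at this
    simp only [Matrix.conjTranspose_apply] at this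
    simp only [mul_comm (V _ p), this, eq_comm]
  have hRR : ∑ b, ∑ e, R (e, b) * star (R (e, b)) = 1 := by
    have h := (isDensity_pureState hR).2
    rw [Matrix.trace, Fintype.sum_prod_type_right] at h
    exact h
  have h1 : ∀ b, ∑ y, repKernel V R (x, (y, b)) (x', (y, b)) =
      if x = x' then ∑ e, R (e, b) * star (R (e, b)) else 0 := by
    intro b
    calc ∑ y, repKernel V R (x, (y, b)) (x', (y, b))
        = ∑ r : δ × Fin eout, ∑ e, ∑ e', (V r (x, e) * star (V r (x', e'))) *
            (R (e, b) * star (R (e', b))) := by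
          rw [Fintype.sum_prod_type]
          simp only [repKernel, repAmp, Matrix.of_apply, star_sum, star_mul', Finset.sum_mul_sum]
          refine Finset.sum_congr rfl fun y _ => Finset.sum_congr rfl fun f _ =>
            Finset.sum_congr rfl fun e _ => Finset.sum_congr rfl fun e' _ => ?_
          ring
      _ = ∑ e, ∑ e', (∑ r, V r (x, e) * star (V r (x', e'))) * (R (e, b) * star (R (e', b))) := by
          rw [Finset.sum_comm]
          refine Finset.sum_congr rfl fun e _ => ?_
          rw [Finset.sum_comm]
          simp only [Finset.sum_mul]
      _ = _ := by
          simp only [hV', Prod.mk.injEq]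
          by_cases hx : x = x' <;> simp [hx]
  rw [Fintype.sum_prod_type_right]
  simp only [h1]
  by_cases hx : x = x'
  · simpa [hx] using hRR
  · simp [hx]

end RepKernel

/-! ### Amplitudes of sequential circuits -/

section Amplitudes

variable {N d : ℕ} {κ : Fin N → Type*} {β : Type*}

/-- The parties that have acted before time `t` in the order `σ`. -/
def actedBefore (σ : Equiv.Perm (Fin N)) (t : ℕ) : Finset (Fin N) :=
  Finset.univ.filter fun j => (σ.symm j).val < t

lemma mem_actedBefore {σ : Equiv.Perm (Fin N)} {t : ℕ} {j : Fin N} :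
    j ∈ actedBefore σ t ↔ (σ.symm j).val < t := by
  simp [actedBefore]

lemma actedBefore_zero (σ : Equiv.Perm (Fin N)) : actedBefore σ 0 = ∅ := by
  ext j
  simp [mem_actedBefore]

lemma actedBefore_last (σ : Equiv.Perm (Fin N)) : actedBefore σ N = Finset.univ := by
  ext j
  simp [mem_actedBefore]

lemma notMem_actedBefore (σ : Equiv.Perm (Fin N)) (t : Fin N) : σ t ∉ actedBefore σ t.val := by
  simp [mem_actedBefore]

lemma actedBefore_succ (σ : Equiv.Perm (Fin N)) (t : Fin N) :
    actedBefore σ (t.val + 1) = insert (σ t) (actedBefore σ t.val) := by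
  ext j
  rw [Finset.mem_insert, mem_actedBefore, mem_actedBefore, ← Equiv.symm_apply_eq, Fin.ext_iff]
  omega

/-- Every set of parties consists of the first parties of some order. -/
lemma exists_actedBefore_eq (S : Finset (Fin N)) :
    ∃ (σ : Equiv.Perm (Fin N)) (t : ℕ), t ≤ N ∧ actedBefore σ t = S := by
  have hcard : S.card ≤ N := by simpa using Finset.card_le_univ S
  have e : {i : Fin N // i.val < S.card} ≃ {j : Fin N // j ∈ S} := by
    refine Fintype.equivOfCardEq ?_
    rw [Fintype.card_coe, Fintype.card_subtype]
    have := Fin.card_filter_val_lt (n := N) (m := S.card)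
    rw [this, min_eq_right hcard]
  refine ⟨e.extendSubtype, S.card, hcard, ?_⟩
  ext j
  rw [mem_actedBefore]
  constructor
  · intro h
    have := e.extendSubtype_mem _ h
    simpa using this
  · intro h
    by_contra hn
    have := e.extendSubtype_not_mem _ hn
    simp [h] at this

/-- The amplitude, after the first `t` local steps, of outputs `y` and ancilla state `f` for input
`x` and Bob's basis state `b`. It involves `x` and `y` only at the parties that have acted. -/
def amp (σ : Equiv.Perm (Fin N)) (e : ℕ → ℕ)
    (U : ∀ t : Fin N, Matrix (Fin d × Fin (e (t.val + 1))) (κ (σ t) × Fin (e t.val)) ℂ)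
    (R : Fin (e 0) × β → ℂ) :
    (t : ℕ) → t ≤ N → (∀ j, κ j) → (Fin N → Fin d) → β → Fin (e t) → ℂ
  | 0, _ => fun _ _ b f => R (f, b)
  | t + 1, h => fun x y b f => ∑ e', U ⟨t, h⟩ (y (σ ⟨t, h⟩), f) (x (σ ⟨t, h⟩), e') *
      amp σ e U R t (Nat.le_of_succ_le h) x y b e'

variable {σ : Equiv.Perm (Fin N)} {e : ℕ → ℕ}
  {U : ∀ t : Fin N, Matrix (Fin d × Fin (e (t.val + 1))) (κ (σ t) × Fin (e t.val)) ℂ}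
  {R : Fin (e 0) × β → ℂ}

lemma amp_congr (t : ℕ) (ht : t ≤ N) {x x' : ∀ j, κ j} {y y' : Fin N → Fin d}
    (hx : ∀ j ∈ actedBefore σ t, x j = x' j) (hy : ∀ j ∈ actedBefore σ t, y j = y' j) (b : β)
    (f : Fin (e t)) : amp σ e U R t ht x y b f = amp σ e U R t ht x' y' b f := by
  induction t with
  | zero => rfl
  | succ t ih =>
    have hs := actedBefore_succ σ ⟨t, ht⟩
    simp only [hs, Finset.mem_insert, forall_eq_or_imp] at hx hy
    simp only [amp, hx.1, hy.1]
    exact Finset.sum_congr rfl fun e' _ => by rw [ih _ hx.2 hy.2]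

/-- The composite of the first `t` local steps, applied to `|x⟩` and the ancilla state `R`: the
parties that have not acted still hold their inputs, and the others are described by `amp`. -/
lemma sum_composite [∀ j, Fintype (κ j)] [∀ j, DecidableEq (κ j)]
    (t : ℕ) (ht : t ≤ N) (x : ∀ j, κ j) (y : Fin N → Fin d) (b : β)
    (z : ∀ i : {i : Fin N // t ≤ i.val}, κ (σ i)) (f : Fin (e t)) :
    ∑ e₀, composite σ e U t ht ((fun i => y (σ i.1), z), f)
        ((fun i => absurd i.2 (Nat.not_lt_zero _), fun i => x (σ i.1)), e₀) * R (e₀, b) =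
      if ∀ i, z i = x (σ i.1) then amp σ e U R t ht x y b f else 0 := by
  induction t with
  | zero =>
    simp only [composite, Matrix.one_apply, Prod.mk.injEq, amp, ite_mul, one_mul, zero_mul]
    have h0 : (fun i : {i : Fin N // i.val < 0} => y (σ i.1)) =
        fun i => absurd i.2 (Nat.not_lt_zero _) := funext fun i => absurd i.2 (Nat.not_lt_zero _)
    by_cases hz : ∀ i, z i = x (σ i.1)
    · have : z = fun i : {i : Fin N // 0 ≤ i.val} => x (σ i.1) := funext hz
      simp [this, h0]
    · have : z ≠ fun i : {i : Fin N // 0 ≤ i.val} => x (σ i.1) :=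
        fun h => hz fun i => congrFun h i
      simp [this, hz, -Subtype.forall]
  | succ t ih =>
    have ht' : t ≤ N := Nat.le_of_succ_le ht
    simp only [composite, Matrix.mul_apply, Finset.sum_mul]
    rw [Finset.sum_comm]
    simp only [mul_assoc, ← Finset.mul_sum]
    rw [Fintype.sum_prod_type, Fintype.sum_prod_type]
    -- only the stage that agrees with `y` before `t` and with `x` from `t` on contributes
    rw [Finset.sum_eq_single (fun i : {i : Fin N // i.val < t} => y (σ i.1))]
    · simp only [ih]
      refine (Finset.sum_eq_single (fun i : {i : Fin N // t ≤ i.val} => x (σ i.1)) ?_ ?_).trans ?_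
      · intro z' _ hz'
        have : ¬ ∀ i, z' i = x (σ i.1) := fun h => hz' (funext h)
        simp [this, -Subtype.forall]
      · simp
      · by_cases hz : ∀ i, z i = x (σ i.1)
        · simp [localStep, hz, amp]
        · simp [localStep, hz, -Subtype.forall]
    · intro o _ ho
      refine Finset.sum_eq_zero fun z' _ => Finset.sum_eq_zero fun e' _ => ?_
      have : ¬ ∀ i : {i : Fin N // i.val < t}, y (σ i.1) = o i :=
        fun h => ho (funext fun i => (h i).symm)
      simp [localStep, this, -Subtype.forall]
    · simp

lemma sum_composite_last [∀ j, Fintype (κ j)] [∀ j, DecidableEq (κ j)]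
    (x : ∀ j, κ j) (y : Fin N → Fin d) (b : β) (f : Fin (e N)) :
    ∑ e₀, (composite σ e U N le_rfl)
        ((fun i => y (σ i.1), fun i => absurd i.1.isLt (not_lt.mpr i.2)), f)
        ((fun i => absurd i.2 (Nat.not_lt_zero _), fun i => x (σ i.1)), e₀) * R (e₀, b) =
      amp σ e U R N le_rfl x y b f := by
  rw [sum_composite, if_pos]
  exact fun i => absurd i.1.isLt (not_lt.mpr i.2)

/-- A local isometry, with its output traced out, acts on its input as the trace. -/
lemma sum_amp_succ [∀ j, DecidableEq (κ j)]
    (t : Fin N) (hU : (U t).conjTranspose * U t = 1) (x x' : ∀ j, κ j)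
    (y y' : Fin N → Fin d) (b b' : β) :
    ∑ v, ∑ f, amp σ e U R (t.val + 1) t.isLt x (Function.update y (σ t) v) b f *
        star (amp σ e U R (t.val + 1) t.isLt x' (Function.update y' (σ t) v) b' f) =
      if x (σ t) = x' (σ t) then ∑ f, amp σ e U R t.val t.isLt.le x y b f *
        star (amp σ e U R t.val t.isLt.le x' y' b' f) else 0 := by
  have hU' : ∀ p q, ∑ r, U t r p * star (U t r q) = if p = q then 1 else 0 := by
    intro p q
    have := congrFun (congrFun hU q) p
    rw [Matrix.mul_apply, Matrix.one_apply] at this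
    simp only [Matrix.conjTranspose_apply] at this
    simp only [mul_comm (U t _ p), this, eq_comm]
  have hc : ∀ (x : ∀ j, κ j) (y : Fin N → Fin d) v b f,
      amp σ e U R t.val t.isLt.le x (Function.update y (σ t) v) b f =
        amp σ e U R t.val t.isLt.le x y b f := by
    intro x y v b f
    refine amp_congr _ _ (fun _ _ => rfl) (fun j hj => ?_) b f
    rw [Function.update_of_ne]
    rintro rfl
    exact notMem_actedBefore σ t hj
  have ha : ∀ (x : ∀ j, κ j) (y : Fin N → Fin d) v b f,
      amp σ e U R (t.val + 1) t.isLt x (Function.update y (σ t) v) b f =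
        ∑ e', U t (v, f) (x (σ t), e') * amp σ e U R t.val t.isLt.le x y b e' := by
    intro x y v b f
    simp only [amp, hc, Fin.eta, Function.update_self]
  simp only [ha]
  set a := amp σ e U R t.val t.isLt.le x y b
  set a' := amp σ e U R t.val t.isLt.le x' y' b'
  calc _ = ∑ r, ∑ p, ∑ q, (U t r (x (σ t), p) * star (U t r (x' (σ t), q))) *
            (a p * star (a' q)) := by
        rw [Fintype.sum_prod_type]
        simp only [star_sum, star_mul', Finset.sum_mul_sum]
        refine Finset.sum_congr rfl fun v _ => Finset.sum_congr rfl fun f _ =>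
          Finset.sum_congr rfl fun p _ => Finset.sum_congr rfl fun q _ => ?_
        ring
    _ = ∑ p, ∑ q, (∑ r, U t r (x (σ t), p) * star (U t r (x' (σ t), q))) *
            (a p * star (a' q)) := by
        rw [Finset.sum_comm]
        refine Finset.sum_congr rfl fun p _ => ?_
        rw [Finset.sum_comm]
        simp only [Finset.sum_mul]
    _ = _ := by
        simp only [hU', Prod.mk.injEq]
        by_cases hx : x (σ t) = x' (σ t) <;> simp [hx]

/-- Tracing out the parties that act at time `t` or later leaves the Gram matrix of the amplitudes
at time `t`. -/
lemma marg_amp [∀ j, DecidableEq (κ j)]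
    (hU : ∀ t, (U t).conjTranspose * U t = 1)
    {C : Matrix ((∀ j, κ j) × ((Fin N → Fin d) × β)) ((∀ j, κ j) × ((Fin N → Fin d) × β)) ℂ}
    (hC : ∀ x y b x' y' b', C (x, (y, b)) (x', (y', b')) =
      ∑ f, amp σ e U R N le_rfl x y b f * star (amp σ e U R N le_rfl x' y' b' f))
    (t : ℕ) (ht : t ≤ N) (x x' : ∀ j, κ j) (y y' : Fin N → Fin d) (b b' : β) :
    marg (actedBefore σ t) C (x, (y, b)) (x', (y', b')) =
      if ∀ j ∉ actedBefore σ t, x j = x' j then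
        ∑ f, amp σ e U R t ht x y b f * star (amp σ e U R t ht x' y' b' f) else 0 := by
  induction ht using Nat.decreasingInduction generalizing x x' y y' with
  | self =>
    rw [actedBefore_last, marg_univ, hC]
    simp
  | of_succ t ht ih =>
    rw [marg_eq_sum_insert (notMem_actedBefore σ ⟨t, ht⟩), ← actedBefore_succ σ ⟨t, ht⟩]
    simp only [ih]
    have hiff : (∀ j ∉ actedBefore σ t, x j = x' j) ↔
        (∀ j ∉ actedBefore σ (t + 1), x j = x' j) ∧ x (σ ⟨t, ht⟩) = x' (σ ⟨t, ht⟩) := by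
      have hs := actedBefore_succ σ ⟨t, ht⟩
      have hn := notMem_actedBefore σ ⟨t, ht⟩
      simp only at hs hn
      rw [hs]
      constructor
      · intro h
        exact ⟨fun j hj => h j fun h' => hj (Finset.mem_insert_of_mem h'), h _ hn⟩
      · rintro ⟨h, h'⟩ j hj
        by_cases hjt : j = σ ⟨t, ht⟩
        · rw [hjt, h']
        · exact h j (by simp [hjt, hj])
    by_cases h1 : ∀ j ∉ actedBefore σ (t + 1), x j = x' j
    · simp only [if_pos h1]
      rw [sum_amp_succ ⟨t, ht⟩ (hU _)]
      exact if_congr ⟨fun h => hiff.mpr ⟨h1, h⟩, fun h => (hiff.mp h).2⟩ rfl rfl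
    · rw [if_neg fun h => h1 (hiff.mp h).1]
      simp only [if_neg h1, Finset.sum_const_zero]

end Amplitudes

section ToKernel

variable {N d : ℕ} {κ : Fin N → Type*} [∀ j, Fintype (κ j)] [∀ j, DecidableEq (κ j)]
variable {β : Type*} [Fintype β] [DecidableEq β]

/-- A map with a unitary representation is given by a causal kernel: for each set `S` of parties,
use the factorization of `V` in which the parties in `S` act first. -/
lemma HasUnitaryRep.exists_causalKernel
    {Λ : Matrix ((∀ j, κ j) × β) ((∀ j, κ j) × β) ℂ →ₗ[ℂ]
      Matrix ((Fin N → Fin d) × β) ((Fin N → Fin d) × β) ℂ} (hΛ : HasUnitaryRep Λ) :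
    ∃ C, IsCausalKernel C ∧ ∀ X, Λ X = kerMap C (traceSnd X) := by
  obtain ⟨ein, eout, R, V, hR, hV, hrep, hseq⟩ := hΛ
  refine ⟨repKernel V R, ⟨?_, ?_, ?_⟩, fun X => by rw [hrep, traceAncilla_evolve]⟩
  · exact posSemidef_of_fun_mul_star
      fun (p : (∀ j, κ j) × ((Fin N → Fin d) × β)) => repAmp V R p.1 p.2.1 p.2.2
  · exact repKernel_unitTrace hV.1 hR
  · intro S x x' z y y' b b'
    obtain ⟨σ, t, ht, rfl⟩ := exists_actedBefore_eq S
    obtain ⟨W, ⟨e, h0, hN, U, hU, rfl⟩, hW⟩ := hseq σ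
    subst h0 hN
    have hamp : ∀ x y b f, repAmp V R x y b f = amp σ e U R N le_rfl x y b f := by
      intro x y b f
      have h := congrFun (hW (Pi.single x 1)) ((y, f), b)
      simp only [applyToAncilla_apply, Pi.single_apply, ite_mul, one_mul, zero_mul,
        Finset.sum_ite_eq', Finset.mem_univ, if_true] at h
      rw [h, ← sum_composite_last]
      rfl
    have hC := marg_amp (C := repKernel V R) (R := R) (fun t => (hU t).1)
      (fun x y b x' y' b' => by simp only [repKernel, Matrix.of_apply, hamp]) t ht
    rw [hC, hC]
    refine ⟨fun h => ?_, fun h => if_neg h⟩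
    rw [if_pos h, if_pos fun j hj => by simp [hj]]
    refine Finset.sum_congr rfl fun f _ => ?_
    congr 1
    · exact amp_congr t ht (fun j hj => by simp [hj]) (fun _ _ => rfl) b f
    · exact congrArg star (amp_congr t ht (fun j hj => by simp [hj]) (fun _ _ => rfl) b' f)

end ToKernel
/-! ### Unitary representations from causal kernels -/

section FromKernel

variable {N d : ℕ}

lemma piecewise_actedBefore_zero {π : Fin N → Type*} (σ : Equiv.Perm (Fin N)) (x z : ∀ j, π j) :
    (actedBefore σ 0).piecewise x z = z := by
  funext j
  exact Finset.piecewise_eq_of_notMem _ _ _ (by simp [actedBefore_zero])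

variable {κ : Fin N → Type*} [∀ j, Fintype (κ j)] {β : Type*} [Fintype β]

/-- The dimension of the ancilla once exactly the parties in `S` have acted. The first factor is
large enough for all the Gram factorizations, and the others make
`d * ancillaDim (insert k S) = |κ k| * ancillaDim S`. -/
def ancillaDim (d : ℕ) (κ : Fin N → Type*) [∀ j, Fintype (κ j)] (β : Type*) [Fintype β]
    (S : Finset (Fin N)) : ℕ :=
  Fintype.card ((∀ j, κ j) × ((Fin N → Fin d) × β)) * (d ^ (N - S.card)) *
    ∏ j ∈ S, Fintype.card (κ j)

lemma mul_ancillaDim_insert {S : Finset (Fin N)} {k : Fin N} (hk : k ∉ S) :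
    d * ancillaDim d κ β (insert k S) = Fintype.card (κ k) * ancillaDim d κ β S := by
  have h1 : (insert k S).card ≤ N := by simpa using Finset.card_le_univ (insert k S)
  rw [Finset.card_insert_of_notMem hk] at h1
  obtain ⟨m, hm⟩ := Nat.exists_eq_add_of_le h1
  have h2 : N - S.card = m + 1 := by omega
  have h3 : N - (S.card + 1) = m := by omega
  rw [ancillaDim, ancillaDim, Finset.prod_insert hk, Finset.card_insert_of_notMem hk, h2, h3]
  ring

lemma card_le_ancillaDim [∀ j, Nonempty (κ j)] (y₀ : Fin N → Fin d) (S : Finset (Fin N)) :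
    Fintype.card ((∀ j, κ j) × ((Fin N → Fin d) × β)) ≤ ancillaDim d κ β S := by
  have h1 : 0 < d ^ (N - S.card) := by
    rcases Nat.eq_zero_or_pos N with rfl | hN
    · simp
    · exact Nat.pow_pos ((Nat.zero_le _).trans_lt (y₀ ⟨0, hN⟩).isLt)
  have h2 : 0 < ∏ j ∈ S, Fintype.card (κ j) := Finset.prod_pos fun j _ => Fintype.card_pos
  rw [ancillaDim, mul_assoc]
  exact Nat.le_mul_of_pos_right _ (Nat.mul_pos h1 h2)

/-- A Stinespring dilation of the channel from the parties in `S` to the parties in `S` and Bob: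
vectors in the ancilla space whose Gram matrix is the marginal of `C` on `S`. The entries of `x` and
`y` outside `S` are replaced by those of the reference configurations `x₀` and `y₀`. -/
noncomputable def dilation
    (C : Matrix ((∀ j, κ j) × ((Fin N → Fin d) × β)) ((∀ j, κ j) × ((Fin N → Fin d) × β)) ℂ)
    (x₀ : ∀ j, κ j) (y₀ : Fin N → Fin d) (S : Finset (Fin N)) (x : ∀ j, κ j) (y : Fin N → Fin d)
    (b : β) (f : Fin (ancillaDim d κ β S)) : ℂ :=
  factor (marg S C) (ancillaDim d κ β S) (S.piecewise x x₀, (S.piecewise y y₀, b)) f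

variable {C : Matrix ((∀ j, κ j) × ((Fin N → Fin d) × β)) ((∀ j, κ j) × ((Fin N → Fin d) × β)) ℂ}
  {x₀ : ∀ j, κ j} {y₀ : Fin N → Fin d}

lemma dilation_cast {S S' : Finset (Fin N)} (h : S = S')
    (hd : ancillaDim d κ β S = ancillaDim d κ β S') (x : ∀ j, κ j) (y : Fin N → Fin d) (b : β)
    (f : Fin (ancillaDim d κ β S)) :
    dilation C x₀ y₀ S' x y b (Fin.cast hd f) = dilation C x₀ y₀ S x y b f := by
  subst h
  rfl

variable [∀ j, DecidableEq (κ j)] [∀ j, Nonempty (κ j)]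

lemma dilation_gram (hC : IsCausalKernel C) (S : Finset (Fin N)) (x x' : ∀ j, κ j)
    (y y' : Fin N → Fin d) (b b' : β) :
    ∑ f, dilation C x₀ y₀ S x y b f * star (dilation C x₀ y₀ S x' y' b' f) =
      marg S C (S.piecewise x x₀, (y, b)) (S.piecewise x' x₀, (y', b')) := by
  simp only [dilation]
  rw [factor_spec (posSemidef_marg S hC.posSemidef) (card_le_ancillaDim y₀ S), marg_piecewise]

lemma dilation_gram_insert (hC : IsCausalKernel C) {S : Finset (Fin N)} {k : Fin N} (hk : k ∉ S)
    (x x' : ∀ j, κ j) (y y' : Fin N → Fin d) (b b' : β) :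
    ∑ q : Fin d × Fin (ancillaDim d κ β (insert k S)),
      dilation C x₀ y₀ (insert k S) x (Function.update y k q.1) b q.2 *
        star (dilation C x₀ y₀ (insert k S) x' (Function.update y' k q.1) b' q.2) =
      marg S C ((insert k S).piecewise x x₀, (y, b)) ((insert k S).piecewise x' x₀, (y', b')) := by
  rw [marg_eq_sum_insert hk, Fintype.sum_prod_type]
  simp_rw [dilation_gram hC]

/-- When one more party `k` acts, the dilation is updated by a unitary on the system of `k` and the
ancilla: tracing out the output of `k`, both sides dilate the same channel. -/
lemma exists_unitary_step (hC : IsCausalKernel C) {S S' : Finset (Fin N)} {k : Fin N}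
    (hk : k ∉ S) (hS' : S' = insert k S) :
    ∃ U : Matrix (Fin d × Fin (ancillaDim d κ β S')) (κ k × Fin (ancillaDim d κ β S)) ℂ,
      IsUnitaryOp U ∧ ∀ x y b f, dilation C x₀ y₀ S' x y b f =
        ∑ e, U (y k, f) (x k, e) * dilation C x₀ y₀ S x y b e := by
  subst hS'
  obtain ⟨U, hU, h⟩ := exists_unitary_of_gram_eq
    (m := (∀ j, κ j) × ((Fin N → Fin d) × β))
    (r := Fin d × Fin (ancillaDim d κ β (insert k S))) (s := κ k × Fin (ancillaDim d κ β S))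
    (by simp [mul_ancillaDim_insert hk])
    (fun p q => if p.1 k = q.1 then dilation C x₀ y₀ S p.1 p.2.1 p.2.2 q.2 else 0)
    (fun p q => dilation C x₀ y₀ (insert k S) p.1 (Function.update p.2.1 k q.1) p.2.2 q.2) (by
      rintro ⟨x, y, b⟩ ⟨x', y', b'⟩
      have hA : ∑ q : κ k × Fin (ancillaDim d κ β S),
          (if x k = q.1 then dilation C x₀ y₀ S x y b q.2 else 0) *
            star (if x' k = q.1 then dilation C x₀ y₀ S x' y' b' q.2 else 0) =
          if x k = x' k then marg S C (S.piecewise x x₀, (y, b)) (S.piecewise x' x₀, (y', b'))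
            else 0 := by
        rw [← dilation_gram (y₀ := y₀) hC, Fintype.sum_prod_type]
        by_cases h : x k = x' k <;> simp [h, apply_ite star]
      have hB := dilation_gram_insert (x₀ := x₀) (y₀ := y₀) hC hk x x' y y' b b'
      refine hA.trans (Eq.trans ?_ hB.symm)
      have hc := hC.causal S ((insert k S).piecewise x x₀) ((insert k S).piecewise x' x₀) x₀
        y y' b b'
      have hp : ∀ x : ∀ j, κ j,
          S.piecewise ((insert k S).piecewise x x₀) x₀ = S.piecewise x x₀ := by
        intro x
        funext j
        by_cases hj : j ∈ S <;> simp [hj]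
      have hagree : (∀ j ∉ S, (insert k S).piecewise x x₀ j = (insert k S).piecewise x' x₀ j) ↔
          x k = x' k := by
        constructor
        · intro h
          simpa using h k hk
        · intro h j hj
          by_cases hjk : j = k
          · subst hjk
            simpa using h
          · simp [hj, hjk]
      rw [hagree, hp, hp] at hc
      split_ifs with hx
      · exact (hc.1 hx).symm
      · exact (hc.2 hx).symm)
  refine ⟨U, hU, fun x y b f => ?_⟩
  have h2 := h (x, (y, b)) (y k, f)
  simp only [Function.update_eq_self] at h2
  rw [h2, Fintype.sum_prod_type]
  simp

/-- The unitary of the representation, obtained in one step from the dilations for no party and for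
all parties. -/
lemma exists_unitary_total (hC : IsCausalKernel C) :
    ∃ V : Matrix ((Fin N → Fin d) × Fin (ancillaDim d κ β Finset.univ))
        ((∀ j, κ j) × Fin (ancillaDim d κ β ∅)) ℂ,
      IsUnitaryOp V ∧ ∀ x y b f, dilation C x₀ y₀ Finset.univ x y b f =
        ∑ e, V (y, f) (x, e) * dilation C x₀ y₀ ∅ x₀ y₀ b e := by
  obtain ⟨V, hV, h⟩ := exists_unitary_of_gram_eq
    (m := (∀ j, κ j) × β)
    (r := (Fin N → Fin d) × Fin (ancillaDim d κ β Finset.univ))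
    (s := (∀ j, κ j) × Fin (ancillaDim d κ β ∅))
    (by
      simp only [Fintype.card_prod, Fintype.card_fin, ancillaDim, Fintype.card_pi,
        Finset.prod_const, Finset.card_univ, Finset.card_empty, Finset.prod_empty, Nat.sub_zero,
        Nat.sub_self]
      ring)
    (fun p q => if p.1 = q.1 then dilation C x₀ y₀ ∅ x₀ y₀ p.2 q.2 else 0)
    (fun p q => dilation C x₀ y₀ Finset.univ p.1 q.1 p.2 q.2) (by
      rintro ⟨x, b⟩ ⟨x', b'⟩
      have hA : ∑ q : (∀ j, κ j) × Fin (ancillaDim d κ β ∅),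
          (if x = q.1 then dilation C x₀ y₀ ∅ x₀ y₀ b q.2 else 0) *
            star (if x' = q.1 then dilation C x₀ y₀ ∅ x₀ y₀ b' q.2 else 0) =
          if x = x' then marg ∅ C (x₀, (y₀, b)) (x₀, (y₀, b')) else 0 := by
        have h0 := dilation_gram (x₀ := x₀) (y₀ := y₀) hC ∅ x₀ x₀ y₀ y₀ b b'
        rw [Finset.piecewise_empty] at h0
        rw [← h0, Fintype.sum_prod_type]
        by_cases h : x = x' <;> simp [h, apply_ite star]
      have hB : ∑ q : (Fin N → Fin d) × Fin (ancillaDim d κ β Finset.univ),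
          dilation C x₀ y₀ Finset.univ x q.1 b q.2 *
            star (dilation C x₀ y₀ Finset.univ x' q.1 b' q.2) =
          marg ∅ C (x, (y₀, b)) (x', (y₀, b')) := by
        rw [marg_empty_apply, Fintype.sum_prod_type]
        refine Finset.sum_congr rfl fun y _ => ?_
        rw [dilation_gram hC, marg_univ, Finset.piecewise_univ, Finset.piecewise_univ]
      refine hA.trans (Eq.trans ?_ hB.symm)
      have hc := hC.causal ∅ x x' x₀ y₀ y₀ b b'
      rw [Finset.piecewise_empty, Finset.piecewise_empty] at hc
      split_ifs with hx
      · exact (hc.1 fun j _ => congrFun hx j).symm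
      · exact (hc.2 fun h => hx (funext fun j => h j (Finset.notMem_empty j))).symm)
  refine ⟨V, hV, fun x y b f => ?_⟩
  rw [h (x, b) (y, f), Fintype.sum_prod_type]
  simp

/-- Conversely, a map given by a causal kernel has a unitary representation. For every order the
dilations along the growing set of parties are linked by local unitaries, and the first and the last
of these dilations do not depend on the order. -/
theorem hasUnitaryRep_of_causalKernel [DecidableEq β] (hC : IsCausalKernel C)
    {Λ : Matrix ((∀ j, κ j) × β) ((∀ j, κ j) × β) ℂ →ₗ[ℂ]
      Matrix ((Fin N → Fin d) × β) ((Fin N → Fin d) × β) ℂ}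
    (hΛ : ∀ X, Λ X = kerMap C (traceSnd X)) : HasUnitaryRep Λ := by
  let x₀ : ∀ j, κ j := fun j => Classical.arbitrary _
  obtain ⟨y₀⟩ : Nonempty (Fin N → Fin d) := by
    by_contra hE
    rw [not_nonempty_iff] at hE
    simpa using hC.unitTrace x₀ x₀
  obtain ⟨V, hV, hVd⟩ := exists_unitary_total (x₀ := x₀) (y₀ := y₀) hC
  let R : EuclideanSpace ℂ (Fin (ancillaDim d κ β ∅) × β) :=
    WithLp.toLp 2 fun p => dilation C x₀ y₀ ∅ x₀ y₀ p.2 p.1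
  -- `R` purifies Bob's state, and `V` turns it into the dilation for all parties
  have hVamp : ∀ x y b f, repAmp V R x y b f = dilation C x₀ y₀ Finset.univ x y b f :=
    fun x y b f => (hVd x y b f).symm
  refine ⟨_, _, R, V, ?_, hV, fun X => ?_, fun σ => ?_⟩
  · have h1 : ∑ p, R p * star (R p) = 1 := by
      rw [Fintype.sum_prod_type_right]
      simp only [R]
      simp_rw [dilation_gram hC, Finset.piecewise_empty, marg_empty_apply]
      rw [← Fintype.sum_prod_type_right
        (fun o : (Fin N → Fin d) × β => C (x₀, o) (x₀, o)), hC.unitTrace, if_pos rfl]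
    have h2 : ((‖R‖ ^ 2 : ℝ) : ℂ) = 1 := by
      rw [← h1, EuclideanSpace.norm_sq_eq]
      simp [Complex.mul_conj, Complex.normSq_eq_norm_sq]
    have h3 : ‖R‖ ^ 2 = 1 := by exact_mod_cast h2
    exact (pow_eq_one_iff_of_nonneg (norm_nonneg _) two_ne_zero).mp h3
  · rw [hΛ, traceAncilla_evolve]
    have hCV : repKernel V R = C := by
      ext ⟨x, y, b⟩ ⟨x', y', b'⟩
      simp only [repKernel, Matrix.of_apply, hVamp]
      rw [dilation_gram hC, marg_univ, Finset.piecewise_univ, Finset.piecewise_univ]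
    rw [hCV]
  · choose U hU hUd using fun t : Fin N => exists_unitary_step (x₀ := x₀) (y₀ := y₀) hC
      (notMem_actedBefore σ t) (actedBefore_succ σ t)
    have h0 : ancillaDim d κ β ∅ = ancillaDim d κ β (actedBefore σ 0) := by
      rw [actedBefore_zero]
    have hN : ancillaDim d κ β Finset.univ = ancillaDim d κ β (actedBefore σ N) := by
      rw [actedBefore_last]
    let e : ℕ → ℕ := fun t => ancillaDim d κ β (actedBefore σ t)
    let R' : Fin (e 0) × β → ℂ := fun p => dilation C x₀ y₀ (actedBefore σ 0) x₀ y₀ p.2 p.1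
    have hamp : ∀ (t : ℕ) (ht : t ≤ N) x y b f,
        amp σ e U R' t ht x y b f = dilation C x₀ y₀ (actedBefore σ t) x y b f := by
      intro t
      induction t with
      | zero =>
        intro ht x y b f
        simp only [amp, R', dilation, piecewise_actedBefore_zero]
      | succ t ih =>
        intro ht x y b f
        simp only [amp, ih]
        exact (hUd ⟨t, ht⟩ x y b f).symm
    refine ⟨_, ⟨e, h0, hN, U, hU, rfl⟩, fun ψ => ?_⟩
    funext ⟨⟨y, f⟩, b⟩
    rw [applyToAncilla_apply, applyToAncilla_apply]
    refine Finset.sum_congr rfl fun x _ => ?_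
    congr 1
    rw [hVamp, ← dilation_cast (actedBefore_last σ).symm hN, ← hamp N le_rfl,
      ← sum_composite_last]
    refine Fintype.sum_equiv (finCongr h0.symm) _ _ fun e₀ => ?_
    simp only [Matrix.submatrix_apply, R, R']
    rw [← dilation_cast (actedBefore_zero σ) h0.symm]
    rfl

end FromKernel
/-! ### Causal kernels give causal channels -/

section Channels

variable {α m n β : Type*}

/-- The partial trace over the second tensor factor as a linear map. -/
def traceSndHom (α β : Type*) [Fintype β] : Matrix (α × β) (α × β) ℂ →ₗ[ℂ] Matrix α α ℂ where
  toFun X := traceSnd X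
  map_add' X Y := by
    ext x y
    simp [traceSnd, Finset.sum_add_distrib]
  map_smul' r X := by
    ext x y
    simp [traceSnd, Finset.mul_sum]

lemma traceSndHom_apply [Fintype β] (X : Matrix (α × β) (α × β) ℂ) :
    traceSndHom α β X = traceSnd X := rfl

lemma trace_traceSnd [Fintype α] [Fintype β] (X : Matrix (α × β) (α × β) ℂ) :
    (traceSnd X).trace = X.trace := by
  simp [Matrix.trace, traceSnd, Fintype.sum_prod_type]

lemma traceSnd_kronecker_pureState [Fintype β] {v : EuclideanSpace ℂ β} (hv : ‖v‖ = 1)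
    (ρ : Matrix α α ℂ) : traceSnd (ρ ⊗ₖ pureState v) = ρ := by
  have h : ∑ b, pureState v b b = 1 := (isDensity_pureState hv).2
  ext x y
  simp [traceSnd, Matrix.kroneckerMap_apply, ← Finset.mul_sum, h]

lemma isCP_comp_traceSnd [Fintype m] [Fintype n] [Fintype β]
    {Φ : Matrix m m ℂ →ₗ[ℂ] Matrix n n ℂ}
    (hΦ : IsCP Φ) : IsCP (Φ ∘ₗ traceSndHom m β) := by
  intro k X hX
  have h : (∑ b : β, X.submatrix (fun p : m × Fin k => ((p.1, b), p.2))
      (fun p : m × Fin k => ((p.1, b), p.2))).PosSemidef :=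
    Matrix.posSemidef_sum _ fun b _ => hX.submatrix _
  convert hΦ k _ h using 1
  ext ⟨i, p⟩ ⟨j, q⟩
  simp only [ampliation, Matrix.of_apply, LinearMap.comp_apply, traceSndHom_apply]
  refine congrArg (fun Z => Φ Z i j) ?_
  ext x y
  simp [traceSnd, Matrix.sum_apply]

lemma isChannel_kerMap_comp_traceSnd [Fintype m] [DecidableEq m] [Fintype n] [Fintype β]
    {C : Matrix (m × n) (m × n) ℂ} (hC : C.PosSemidef)
    (hC' : ∀ x x', ∑ o, C (x, o) (x', o) = if x = x' then 1 else 0) :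
    IsChannel (kerMap C ∘ₗ traceSndHom m β) :=
  ⟨isCP_comp_traceSnd (isCP_kerMap hC), fun X => by
    rw [LinearMap.comp_apply, trace_kerMap hC', traceSndHom_apply, trace_traceSnd]⟩

variable {N d : ℕ} {κ : Fin N → Type*} [∀ j, Fintype (κ j)] [∀ j, DecidableEq (κ j)]
variable [∀ j, Nonempty (κ j)] [Fintype β]

lemma IsCausalKernel.isCausal
    {C : Matrix ((∀ j, κ j) × ((Fin N → Fin d) × β)) ((∀ j, κ j) × ((Fin N → Fin d) × β)) ℂ}
    (hC : IsCausalKernel C) : IsCausal (kerMap C ∘ₗ traceSndHom (∀ j, κ j) β) := by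
  intro S
  obtain ⟨D, hD⟩ := hC.exists_isMarginal (splits_glueEquiv (κ := κ) S)
    (splits_glueEquiv (κ := fun _ => Fin d) S)
  have hpsd := hD.posSemidef hC.posSemidef
  have htr := hD.unitTrace hC.unitTrace
  have hmarg : ∀ (ρ : Matrix (∀ j, κ j) (∀ j, κ j) ℂ) o o' b b',
      ∑ w, kerMap C ρ (glue S o w, b) (glue S o' w, b') =
        kerMap D (traceCompl S ρ) (o, b) (o', b') := hD.kerMap_apply
  refine ⟨⟨kerMap (Matrix.of fun p q => ∑ b, D (p.1, (p.2, b)) (q.1, (q.2, b))), ⟨?_, ?_⟩, ?_⟩,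
    ⟨kerMap D ∘ₗ traceSndHom _ β, isChannel_kerMap_comp_traceSnd hpsd htr, ?_⟩⟩
  · refine isCP_kerMap ?_
    let g (b : β) (p : (∀ j : {j // j ∈ S}, κ j) × ({j // j ∈ S} → Fin d)) := (p.1, (p.2, b))
    have h : (∑ b : β, D.submatrix (g b) (g b)).PosSemidef :=
      Matrix.posSemidef_sum _ fun b _ => hpsd.submatrix _
    convert h using 1
    ext p q
    simp [g, Matrix.sum_apply]
  · refine trace_kerMap fun u u' => ?_
    rw [← htr, Fintype.sum_prod_type]
    rfl
  · intro ρ _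
    ext o o'
    simp only [traceCompl, traceSnd, Matrix.of_apply, LinearMap.comp_apply, traceSndHom_apply]
    rw [Finset.sum_comm]
    simp only [hmarg]
    simp only [kerMap_apply, Matrix.of_apply, Finset.sum_mul]
    rw [Finset.sum_comm]
    refine Finset.sum_congr rfl fun u _ => ?_
    rw [Finset.sum_comm]
    rfl
  · intro ρ _
    have hcomm : traceSnd (keep S ρ) = traceCompl S (traceSnd ρ) := by
      ext u u'
      simp only [keep, traceCompl, traceSnd, Matrix.of_apply]
      exact Finset.sum_comm
    ext ⟨o, b⟩ ⟨o', b'⟩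
    refine (hmarg (traceSnd ρ) o o' b b').trans ?_
    rw [← hcomm]
    rfl

end Channels

/-! ### Teleportages defined by causal kernels are non-signalling -/

section Measurement

variable {ι : Type*} [Fintype ι] {d : ℕ}

/-- The product vector `⊗ₖ |aₖ⟩`. -/
noncomputable def outcomeVec
    (bs : ι → OrthonormalBasis (Fin d) ℂ (EuclideanSpace ℂ (Fin d))) (a y : ι → Fin d) : ℂ :=
  ∏ k, bs k (a k) (y k)

lemma outcomeProj_apply [DecidableEq ι]
    (bs : ι → OrthonormalBasis (Fin d) ℂ (EuclideanSpace ℂ (Fin d))) (a y y' : ι → Fin d) :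
    outcomeProj bs a y y' = outcomeVec bs a y * star (outcomeVec bs a y') := by
  simp [outcomeProj, outcomeVec, Finset.prod_mul_distrib]

lemma sum_outcomeVec [DecidableEq ι]
    (bs : ι → OrthonormalBasis (Fin d) ℂ (EuclideanSpace ℂ (Fin d))) (y y' : ι → Fin d) :
    ∑ a, outcomeVec bs a y * star (outcomeVec bs a y') = if y = y' then 1 else 0 := by
  have h1 : ∀ k, ∑ i, bs k i (y k) * star (bs k i (y' k)) = if y k = y' k then 1 else 0 := by
    intro k
    have h := (bs k).sum_inner_mul_inner (EuclideanSpace.single (y k) (1 : ℂ))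
      (EuclideanSpace.single (y' k) (1 : ℂ))
    simpa [EuclideanSpace.inner_single_left, EuclideanSpace.inner_single_right,
      PiLp.single_apply, eq_comm (a := y' k)] using h
  simp only [outcomeVec, star_prod, ← Finset.prod_mul_distrib]
  have h2 := Finset.prod_univ_sum (fun _ : ι => (Finset.univ : Finset (Fin d)))
    (fun k i => bs k i (y k) * star (bs k i (y' k)))
  rw [Fintype.piFinset_univ] at h2
  rw [← h2]
  simp only [h1, Finset.prod_ite_zero, Finset.prod_const_one, Finset.mem_univ, forall_const,
    funext_iff]

/-- The Choi matrix of `X ↦ tr_out {(|v⟩⟨v| ⊗ 1) Φ(X)}` when `C` is that of `Φ`. -/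
def outcomeKernel {X Y β : Type*} [Fintype Y] (v : Y → ℂ)
    (C : Matrix (X × (Y × β)) (X × (Y × β)) ℂ) : Matrix (X × β) (X × β) ℂ :=
  Matrix.of fun p q =>
    ∑ o, ∑ o', star (v o) * C (p.1, (o, p.2)) (q.1, (o', q.2)) * v o'

section Kernel

variable {X X₁ X₂ Y Y₁ Y₂ β : Type*} [Fintype Y]

lemma posSemidef_outcomeKernel [Finite X] [Finite β] (v : Y → ℂ)
    {C : Matrix (X × (Y × β)) (X × (Y × β)) ℂ} (hC : C.PosSemidef) :
    (outcomeKernel v C).PosSemidef := by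
  have h := posSemidef_compressFst
    (hC.submatrix fun p : Y × (X × β) => (p.2.1, (p.1, p.2.2))) (fun o => star (v o))
  simp only [star_star] at h
  exact h

lemma kerMap_outcomeKernel_apply [Fintype X] (v : Y → ℂ)
    (C : Matrix (X × (Y × β)) (X × (Y × β)) ℂ) (ρ : Matrix X X ℂ) (b b' : β) :
    kerMap (outcomeKernel v C) ρ b b' =
      ∑ y, ∑ y', v y * star (v y') * kerMap C ρ (y', b) (y, b') := by
  simp only [kerMap_apply, outcomeKernel, Matrix.of_apply, Finset.sum_mul, Finset.mul_sum]
  conv_lhs => enter [2, x]; rw [Finset.sum_comm]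
  rw [Finset.sum_comm]
  conv_rhs => rw [Finset.sum_comm]
  refine Finset.sum_congr rfl fun o _ => ?_
  conv_lhs => enter [2, x]; rw [Finset.sum_comm]
  rw [Finset.sum_comm]
  refine Finset.sum_congr rfl fun o' _ => Finset.sum_congr rfl fun x _ =>
    Finset.sum_congr rfl fun x' _ => ?_
  ring

/-- Summing over the outcomes of a complete measurement amounts to tracing out the outputs. -/
lemma sum_outcomeKernel {A : Type*} [Fintype A] [DecidableEq Y] {v : A → Y → ℂ}
    (hv : ∀ y y', ∑ a, v a y * star (v a y') = if y = y' then 1 else 0)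
    (C : Matrix (X × (Y × β)) (X × (Y × β)) ℂ) (x x' : X) (b b' : β) :
    ∑ a, outcomeKernel (v a) C (x, b) (x', b') = ∑ y, C (x, (y, b)) (x', (y, b')) := by
  simp only [outcomeKernel, Matrix.of_apply]
  rw [Finset.sum_comm]
  refine Finset.sum_congr rfl fun y _ => ?_
  rw [Finset.sum_comm]
  calc _ = ∑ y', (∑ a, v a y' * star (v a y)) * C (x, (y, b)) (x', (y', b')) := by
        refine Finset.sum_congr rfl fun y' _ => ?_
        rw [Finset.sum_mul]
        exact Finset.sum_congr rfl fun a _ => by ring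
    _ = _ := by
        simp only [hv]
        simp

lemma kerMap_of_split [Fintype X] [Fintype X₁] [Fintype X₂] [DecidableEq X₂]
    {g : X₁ × X₂ ≃ X} {K : Matrix (X × β) (X × β) ℂ} {K₁ : Matrix (X₁ × β) (X₁ × β) ℂ}
    (h : ∀ u u' v v' b b', K (g (u, v), b) (g (u', v'), b') =
      if v = v' then K₁ (u, b) (u', b') else 0) (ρ : Matrix X X ℂ) :
    kerMap K ρ = kerMap K₁ (traceSecond g ρ) := by
  ext b b'
  simp only [kerMap_apply, traceSecond, Matrix.of_apply]
  have hs : ∀ F : X → ℂ, ∑ x, F x = ∑ u, ∑ v, F (g (u, v)) := fun F => by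
    rw [← Fintype.sum_prod_type', g.sum_comp]
  simp_rw [hs, h]
  refine Finset.sum_congr rfl fun u _ => ?_
  rw [Finset.sum_comm]
  refine Finset.sum_congr rfl fun u' _ => ?_
  simp [Finset.mul_sum]

/-- Summing over the outcomes of the second parties leaves the measurement of the first parties on
the marginal. -/
lemma IsMarginal.sum_outcomeKernel {A₂ : Type*} [Fintype A₂] [Fintype Y₁] [Fintype Y₂]
    [DecidableEq X₂] [DecidableEq Y₂] {gX : X₁ × X₂ ≃ X} {gY : Y₁ × Y₂ ≃ Y}
    {C : Matrix (X × (Y × β)) (X × (Y × β)) ℂ} {D : Matrix (X₁ × (Y₁ × β)) (X₁ × (Y₁ × β)) ℂ}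
    (hD : IsMarginal gX gY C D) {v : A₂ → Y → ℂ} {v₁ : Y₁ → ℂ} {v₂ : A₂ → Y₂ → ℂ}
    (hv : ∀ a o w, v a (gY (o, w)) = v₁ o * v₂ a w)
    (hv₂ : ∀ w w', ∑ a, v₂ a w * star (v₂ a w') = if w = w' then 1 else 0)
    (u u' : X₁) (z z' : X₂) (b b' : β) :
    ∑ a, outcomeKernel (v a) C (gX (u, z), b) (gX (u', z'), b') =
      if z = z' then outcomeKernel v₁ D (u, b) (u', b') else 0 := by
  have hs : ∀ F : Y → ℂ, ∑ y, F y = ∑ o, ∑ w, F (gY (o, w)) := fun F => by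
    rw [← Fintype.sum_prod_type', gY.sum_comp]
  simp only [outcomeKernel, Matrix.of_apply, hs, hv, star_mul']
  calc _ = ∑ o, ∑ o', (star (v₁ o) * v₁ o') * ∑ w, ∑ w', (∑ a, v₂ a w' * star (v₂ a w)) *
            C (gX (u, z), (gY (o, w), b)) (gX (u', z'), (gY (o', w'), b')) := by
        rw [Finset.sum_comm]
        refine Finset.sum_congr rfl fun o _ => ?_
        simp only [Finset.mul_sum, Finset.sum_mul]
        rw [Finset.sum_comm]
        conv_lhs => enter [2, w]; rw [Finset.sum_comm]
        rw [Finset.sum_comm]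
        refine Finset.sum_congr rfl fun o' _ => Finset.sum_congr rfl fun w _ => ?_
        rw [Finset.sum_comm]
        refine Finset.sum_congr rfl fun w' _ => Finset.sum_congr rfl fun a _ => ?_
        ring
    _ = ∑ o, ∑ o', (star (v₁ o) * v₁ o') *
          if z = z' then D (u, (o, b)) (u', (o', b')) else 0 := by
        refine Finset.sum_congr rfl fun o _ => Finset.sum_congr rfl fun o' _ => ?_
        rw [← hD u u' z z' o o' b b']
        simp only [hv₂]
        simp
    _ = _ := by
        split_ifs with hz
        · refine Finset.sum_congr rfl fun o _ => Finset.sum_congr rfl fun o' _ => ?_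
          ring
        · simp

end Kernel

end Measurement

section NonSignalling

variable {N d : ℕ} {κ : Fin N → Type*} {β : Type*} [Fintype β]
variable {C : Matrix ((∀ j, κ j) × ((Fin N → Fin d) × β)) ((∀ j, κ j) × ((Fin N → Fin d) × β)) ℂ}

/-- Bob's output state. For a causal kernel it does not depend on the input `x₀`. -/
def bobState
    (C : Matrix ((∀ j, κ j) × ((Fin N → Fin d) × β)) ((∀ j, κ j) × ((Fin N → Fin d) × β)) ℂ)
    (x₀ : ∀ j, κ j) : Matrix β β ℂ :=
  Matrix.of fun b b' => ∑ y, C (x₀, (y, b)) (x₀, (y, b'))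

lemma IsCausalKernel.sum_outputs [∀ j, DecidableEq (κ j)] [Nonempty (Fin N → Fin d)]
    (hC : IsCausalKernel C)
    (x₀ x x' : ∀ j, κ j) (b b' : β) :
    ∑ y, C (x, (y, b)) (x', (y, b')) = if x = x' then bobState C x₀ b b' else 0 := by
  obtain ⟨y₀⟩ := ‹Nonempty (Fin N → Fin d)›
  have hc := hC.causal ∅ x x' x₀ y₀ y₀ b b'
  rw [Finset.piecewise_empty, Finset.piecewise_empty, marg_empty_apply, marg_empty_apply] at hc
  split_ifs with hx
  · exact hc.1 fun j _ => congrFun hx j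
  · exact hc.2 fun h => hx (funext fun j => h j (Finset.notMem_empty j))

lemma IsCausalKernel.isDensity_bobState [∀ j, DecidableEq (κ j)]
    (hC : IsCausalKernel C) (x₀ : ∀ j, κ j) :
    IsDensity (bobState C x₀) := by
  constructor
  · have h : bobState C x₀ = ∑ y, C.submatrix (fun b => (x₀, (y, b))) (fun b => (x₀, (y, b))) := by
      ext b b'
      simp [bobState, Matrix.sum_apply]
    rw [h]
    exact Matrix.posSemidef_sum _ fun y _ => hC.posSemidef.submatrix _
  · have h := hC.unitTrace x₀ x₀
    rw [Fintype.sum_prod_type_right, if_pos rfl] at h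
    exact h

/-- Measuring the outputs of a group of parties, on the marginal for that group, is a teleportage
for the group that leaves Bob in `bobState` on average; it is what remains of the measurement of
all parties after summing over the outcomes of the others. -/
lemma IsCausalKernel.exists_local_teleportage [∀ j, Fintype (κ j)] [∀ j, DecidableEq (κ j)]
    [Nonempty (Fin N → Fin d)]
    {J K X₂ : Type*} [Fintype J] [DecidableEq J] [Fintype K] [DecidableEq K] {κ₁ : J → Type*}
    [∀ j, Fintype (κ₁ j)] [∀ j, DecidableEq (κ₁ j)] [Fintype X₂] [DecidableEq X₂] [Nonempty X₂]
    (hC : IsCausalKernel C) {S : Finset (Fin N)} {gX : (∀ j, κ₁ j) × X₂ ≃ ∀ j, κ j}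
    {gY : (J → Fin d) × (K → Fin d) ≃ (Fin N → Fin d)} (hX : Splits S gX) (hY : Splits S gY)
    {bs : Fin N → OrthonormalBasis (Fin d) ℂ (EuclideanSpace ℂ (Fin d))}
    {bs₁ : J → OrthonormalBasis (Fin d) ℂ (EuclideanSpace ℂ (Fin d))}
    {bs₂ : K → OrthonormalBasis (Fin d) ℂ (EuclideanSpace ℂ (Fin d))}
    (hv : ∀ a a' o w, outcomeVec bs (gY (a, a')) (gY (o, w)) =
      outcomeVec bs₁ a o * outcomeVec bs₂ a' w) (x₀ : ∀ j, κ j) :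
    ∃ T₁ : (J → Fin d) → Matrix (∀ j, κ₁ j) (∀ j, κ₁ j) ℂ →ₗ[ℂ] Matrix β β ℂ,
      IsTeleportage T₁ ∧ (∀ σ, IsDensity σ → ∑ a, T₁ a σ = bobState C x₀) ∧
      ∀ a X, ∑ a', kerMap (outcomeKernel (outcomeVec bs (gY (a, a'))) C) X =
        T₁ a (traceSecond gX X) := by
  obtain ⟨D, hD⟩ := hC.exists_isMarginal hX hY
  have hsum : ∀ σ : Matrix (∀ j, κ₁ j) (∀ j, κ₁ j) ℂ, IsDensity σ →
      ∑ a, kerMap (outcomeKernel (outcomeVec bs₁ a) D) σ = bobState C x₀ := by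
    intro σ hσ
    ext b b'
    simp only [Matrix.sum_apply, kerMap_apply]
    rw [Finset.sum_comm]
    have h1 : ∀ u, ∑ a, ∑ u', outcomeKernel (outcomeVec bs₁ a) D (u, b) (u', b') * σ u u' =
        bobState C x₀ b b' * σ u u := by
      intro u
      rw [Finset.sum_comm]
      simp only [← Finset.sum_mul, sum_outcomeKernel (sum_outcomeVec bs₁),
        hD.sum_outputs (hC.sum_outputs x₀ · · b b')]
      simp
    simp only [h1, ← Finset.mul_sum]
    have h2 : ∑ u, σ u u = 1 := hσ.2
    rw [h2, mul_one]
  refine ⟨fun a => kerMap (outcomeKernel (outcomeVec bs₁ a) D),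
    ⟨fun a => isCP_kerMap (posSemidef_outcomeKernel _ (hD.posSemidef hC.posSemidef)),
      fun σ hσ => ?_⟩, hsum, fun a X => ?_⟩
  · rw [hsum σ hσ, (hC.isDensity_bobState x₀).2, hσ.2]
  · have hlin : ∑ a', kerMap (outcomeKernel (outcomeVec bs (gY (a, a'))) C) X =
        kerMap (∑ a', outcomeKernel (outcomeVec bs (gY (a, a'))) C) X := by
      ext b b'
      simp only [Matrix.sum_apply, kerMap_apply, Finset.sum_mul]
      rw [Finset.sum_comm]
      refine Finset.sum_congr rfl fun x _ => ?_
      rw [Finset.sum_comm]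
    rw [hlin]
    refine kerMap_of_split (fun u u' v v' b b' => ?_) X
    rw [Matrix.sum_apply]
    exact hD.sum_outcomeKernel (fun a' o w => hv a a' o w) (sum_outcomeVec bs₂) u u' v v' b b'

lemma outcomeVec_glue (bs : Fin N → OrthonormalBasis (Fin d) ℂ (EuclideanSpace ℂ (Fin d)))
    (S : Finset (Fin N)) (a o : {j // j ∈ S} → Fin d) (a' w : {j // j ∉ S} → Fin d) :
    outcomeVec bs (glue S a a') (glue S o w) =
      outcomeVec (fun j : {j // j ∈ S} => bs j) a o *
        outcomeVec (fun j : {j // j ∉ S} => bs j) a' w := by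
  rw [outcomeVec, ← Fintype.prod_subtype_mul_prod_subtype (fun j => j ∈ S)]
  congr 1
  · exact Finset.prod_congr (by ext; simp) fun j _ => by simp [glue, j.2]
  · exact Finset.prod_congr (by ext; simp) fun j _ => by simp [glue, j.2]

/-- A teleportage obtained by measuring the outputs of a causal channel is non-signalling. -/
theorem IsCausalKernel.isNonSignalling [∀ j, Fintype (κ j)] [∀ j, DecidableEq (κ j)]
    [∀ j, Nonempty (κ j)] (hC : IsCausalKernel C)
    {T : (Fin N → Fin d) → Matrix (∀ j, κ j) (∀ j, κ j) ℂ →ₗ[ℂ] Matrix β β ℂ}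
    (bs : Fin N → OrthonormalBasis (Fin d) ℂ (EuclideanSpace ℂ (Fin d)))
    (hT : ∀ a X, T a X = kerMap (outcomeKernel (outcomeVec bs a) C) X) : IsNonSignalling T := by
  intro S
  let x₀ : ∀ j, κ j := fun j => Classical.arbitrary _
  have : Nonempty (Fin N → Fin d) := by
    by_contra hE
    rw [not_nonempty_iff] at hE
    simpa using hC.unitTrace x₀ x₀
  obtain ⟨T₁, h₁, hs₁, hT₁⟩ := hC.exists_local_teleportage (splits_glueEquiv (κ := κ) S)
    (splits_glueEquiv (κ := fun _ => Fin d) S) (bs := bs) 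
    (fun a a' o w => outcomeVec_glue bs S a o a' w) x₀
  obtain ⟨T₂, h₂, hs₂, hT₂⟩ := hC.exists_local_teleportage (splits_glueEquivCompl (κ := κ) S)
    (splits_glueEquivCompl (κ := fun _ => Fin d) S) (bs := bs)
    (fun a a' o w => (outcomeVec_glue bs S a' w a o).trans (mul_comm _ _)) x₀
  refine ⟨T₁, T₂, bobState C x₀, h₁, h₂, hC.isDensity_bobState x₀, hs₁, hs₂,
    fun a X => ?_, fun c X => ?_⟩
  · simp only [hT]
    exact hT₁ a X
  · simp only [hT]
    exact hT₂ c X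

/-- The measurement in `DefinedVia` in terms of kernels. -/
lemma definedVia_iff [∀ j, Fintype (κ j)] [DecidableEq β]
    {T : (Fin N → Fin d) → Matrix (∀ j, κ j) (∀ j, κ j) ℂ →ₗ[ℂ] Matrix β β ℂ}
    {Λ : Matrix ((∀ j, κ j) × β) ((∀ j, κ j) × β) ℂ →ₗ[ℂ]
      Matrix ((Fin N → Fin d) × β) ((Fin N → Fin d) × β) ℂ}
    (hΛ : ∀ X, Λ X = kerMap C (traceSnd X))
    (bs : Fin N → OrthonormalBasis (Fin d) ℂ (EuclideanSpace ℂ (Fin d)))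
    {ket0 : EuclideanSpace ℂ β} (h0 : ‖ket0‖ = 1) :
    DefinedVia T Λ bs ket0 ↔ ∀ a X, T a X = kerMap (outcomeKernel (outcomeVec bs a) C) X := by
  refine forall₂_congr fun a X => ?_
  have h : traceFst ((outcomeProj bs a ⊗ₖ (1 : Matrix β β ℂ)) * Λ (X ⊗ₖ pureState ket0)) =
      kerMap (outcomeKernel (outcomeVec bs a) C) X := by
    rw [hΛ, traceSnd_kronecker_pureState h0]
    ext b b'
    rw [kerMap_outcomeKernel_apply]
    simp only [traceFst, Matrix.of_apply, Matrix.mul_apply, Fintype.sum_prod_type,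
      Matrix.kroneckerMap_apply, Matrix.one_apply, outcomeProj_apply, mul_ite, mul_one, mul_zero,
      ite_mul, zero_mul, Finset.sum_ite_eq, Finset.mem_univ, if_true]
  rw [h]

end NonSignalling

/-! ### Causal kernels from non-signalling teleportages and from causal channels -/

section Construction

variable {N d : ℕ} {κ : Fin N → Type*} [∀ j, Fintype (κ j)] [∀ j, DecidableEq (κ j)]
variable {β : Type*}

/-- The Choi matrix of `ρ ↦ ∑ₐ |a⟩⟨a| ⊗ T_a(ρ)`, where the parties output their outcomes. -/
def instrumentKernel (T : (Fin N → Fin d) → Matrix (∀ j, κ j) (∀ j, κ j) ℂ →ₗ[ℂ] Matrix β β ℂ) :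
    Matrix ((∀ j, κ j) × ((Fin N → Fin d) × β)) ((∀ j, κ j) × ((Fin N → Fin d) × β)) ℂ :=
  Matrix.of fun p q =>
    if p.2.1 = q.2.1 then choi (T p.2.1) (p.1, p.2.2) (q.1, q.2.2) else 0

lemma posSemidef_instrumentKernel [Fintype β]
    {T : (Fin N → Fin d) → Matrix (∀ j, κ j) (∀ j, κ j) ℂ →ₗ[ℂ] Matrix β β ℂ}
    (hT : ∀ a, IsCP (T a)) : (instrumentKernel T).PosSemidef := by
  let e := Fintype.card ((∀ j, κ j) × β)
  have h := posSemidef_of_fun_mul_star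
    (fun (p : (∀ j, κ j) × ((Fin N → Fin d) × β)) (r : (Fin N → Fin d) × Fin e) =>
      if p.2.1 = r.1 then factor (choi (T r.1)) e (p.1, p.2.2) r.2 else 0)
  convert h using 1
  ext ⟨x, y, b⟩ ⟨x', y', b'⟩
  have hf := factor_spec (posSemidef_choi (hT y)) (e := e) le_rfl (x, b) (x', b')
  simp only [instrumentKernel, Matrix.of_apply, ← hf, Fintype.sum_prod_type]
  by_cases hy : y = y'
  · subst hy
    simp [apply_ite star]
  · simp [hy, apply_ite star]

/-- The partial trace of a matrix unit of a split system. -/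
lemma traceCompl_single (S : Finset (Fin N)) (u u' : ∀ j : {j // j ∈ S}, κ j)
    (v v' : ∀ j : {j // j ∉ S}, κ j) :
    traceCompl S (Matrix.single (glue S u v) (glue S u' v') (1 : ℂ)) =
      if v = v' then Matrix.single u u' 1 else 0 := by
  have hinj : ∀ u₁ u₂ v₁ v₂, glue (κ := κ) S u₁ v₁ = glue S u₂ v₂ ↔ u₁ = u₂ ∧ v₁ = v₂ :=
    fun u₁ u₂ v₁ v₂ => ((glueEquiv κ S).injective.eq_iff (a := (u₁, v₁)) (b := (u₂, v₂))).trans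
      Prod.mk_inj
  ext w w'
  simp only [traceCompl, Matrix.of_apply, Matrix.single_apply, hinj]
  by_cases hv : v = v'
  · subst hv
    by_cases h1 : u = w <;> by_cases h2 : u' = w' <;> simp [h1, h2]
  · rw [if_neg hv]
    refine Finset.sum_eq_zero fun z _ => if_neg ?_
    rintro ⟨⟨_, rfl⟩, ⟨_, rfl⟩⟩
    exact hv rfl

/-- Non-signalling teleportages give causal kernels. -/
lemma IsNonSignalling.isCausalKernel [Fintype β]
    {T : (Fin N → Fin d) → Matrix (∀ j, κ j) (∀ j, κ j) ℂ →ₗ[ℂ] Matrix β β ℂ}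
    (hT : IsTeleportage T) (hN : IsNonSignalling T) : IsCausalKernel (instrumentKernel T) := by
  refine ⟨posSemidef_instrumentKernel hT.1, fun x x' => ?_, fun S => ?_⟩
  · have htr : Matrix.traceLinearMap β ℂ ℂ ∘ₗ (∑ a, T a) =
        Matrix.traceLinearMap (∀ j, κ j) ℂ ℂ := by
      refine eq_of_eq_on_density fun ρ hρ => ?_
      simpa [LinearMap.sum_apply] using hT.2 ρ hρ
    have h := LinearMap.congr_fun htr (Matrix.single x x' 1)
    simp only [LinearMap.comp_apply, LinearMap.sum_apply, Matrix.traceLinearMap_apply,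
      Matrix.trace_sum] at h
    rw [Fintype.sum_prod_type]
    simp only [instrumentKernel, Matrix.of_apply, if_true, choi]
    refine h.trans ?_
    by_cases hx : x = x'
    · subst hx
      simp
    · simp [hx]
  · obtain ⟨T₁, T₂, ρB, h₁, h₂, hρ, hs₁, hs₂, hT₁, hT₂⟩ := hN S
    have hD : IsMarginal (glueEquiv κ S) (glueEquiv (fun _ => Fin d) S) (instrumentKernel T)
        (Matrix.of fun p q =>
          if p.2.1 = q.2.1 then choi (T₁ p.2.1) (p.1, p.2.2) (q.1, q.2.2) else 0) := by
      intro u u' v v' o o' b b'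
      simp only [instrumentKernel, Matrix.of_apply, (glueEquiv (fun _ => Fin d) S).injective.eq_iff,
        Prod.mk.injEq, and_true, choi]
      by_cases ho : o = o'
      · subst ho
        simp only [if_true]
        have h := congrFun (congrFun (hT₁ o (Matrix.single (glue S u v) (glue S u' v') 1)) b) b'
        rw [traceCompl_single, Matrix.sum_apply] at h
        refine h.trans ?_
        split_ifs <;> simp
      · simp [ho]
    exact causal_of_isMarginal (splits_glueEquiv S) (splits_glueEquiv S) hD

/-- Reading the outcomes off the outputs in the standard basis recovers the teleportage. -/
lemma eq_kerMap_outcomeKernel_instrumentKernel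
    {T : (Fin N → Fin d) → Matrix (∀ j, κ j) (∀ j, κ j) ℂ →ₗ[ℂ] Matrix β β ℂ}
    (a : Fin N → Fin d) (X : Matrix (∀ j, κ j) (∀ j, κ j) ℂ) :
    T a X = kerMap (outcomeKernel
      (outcomeVec (fun _ => EuclideanSpace.basisFun (Fin d) ℂ) a) (instrumentKernel T)) X := by
  have hvec : ∀ y, outcomeVec (fun _ : Fin N => EuclideanSpace.basisFun (Fin d) ℂ) a y =
      if y = a then 1 else 0 := by
    intro y
    simp only [outcomeVec, EuclideanSpace.basisFun_apply, PiLp.single_apply, Finset.prod_ite_zero,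
      Finset.prod_const_one, Finset.mem_univ, forall_const, funext_iff]
  ext b b'
  rw [kerMap_outcomeKernel_apply]
  conv_lhs => rw [← kerMap_choi (T a)]
  simp [hvec, apply_ite star, kerMap_apply, instrumentKernel]

/-- `keep` as a linear map. -/
def keepHom (κ : Fin N → Type*) [∀ j, Fintype (κ j)] (β : Type*) (S : Finset (Fin N)) :
    Matrix ((∀ j, κ j) × β) ((∀ j, κ j) × β) ℂ →ₗ[ℂ]
      Matrix ((∀ j : {j // j ∈ S}, κ j) × β) ((∀ j : {j // j ∈ S}, κ j) × β) ℂ where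
  toFun X := keep S X
  map_add' X Y := by
    ext p q
    simp [keep, Finset.sum_add_distrib]
  map_smul' r X := by
    ext p q
    simp [keep, Finset.mul_sum]

/-- The linear map `ρ ↦ ρ ⊗ |v⟩⟨v|`. -/
def tensorPure (α : Type*) {β : Type*} (v : EuclideanSpace ℂ β) :
    Matrix α α ℂ →ₗ[ℂ] Matrix (α × β) (α × β) ℂ where
  toFun ρ := ρ ⊗ₖ pureState v
  map_add' X Y := Matrix.add_kronecker X Y _
  map_smul' r X := Matrix.smul_kronecker r X _

/-- Fixing Bob's input of a causal channel leaves a causal kernel. -/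
lemma isCausalKernel_of_isCausal [Fintype β]
    {Λ : Matrix ((∀ j, κ j) × β) ((∀ j, κ j) × β) ℂ →ₗ[ℂ]
      Matrix ((Fin N → Fin d) × β) ((Fin N → Fin d) × β) ℂ} (hΛ : IsChannel Λ)
    (hcausal : IsCausal Λ) {v : EuclideanSpace ℂ β} (hv : ‖v‖ = 1) :
    IsCausalKernel (choi (Λ ∘ₗ tensorPure (∀ j, κ j) v)) := by
  have htr : (pureState v).trace = 1 := (isDensity_pureState hv).2
  refine ⟨posSemidef_choi fun k X hX => ?_, fun x x' => ?_, fun S => ?_⟩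
  · have h := hΛ.1 k _ ((hX.kronecker (isDensity_pureState hv).1).submatrix
      fun p : ((∀ j, κ j) × β) × Fin k => ((p.1.1, p.2), p.1.2))
    exact h
  · have h := hΛ.2 (Matrix.single x x' 1 ⊗ₖ pureState v)
    rw [Matrix.trace_kronecker, htr, mul_one] at h
    refine h.trans ?_
    by_cases hx : x = x'
    · subst hx
      simp
    · simp [hx]
  · obtain ⟨Γ, -, hΓ⟩ := (hcausal S).2
    have hΓ' : keepHom (fun _ => Fin d) β S ∘ₗ Λ = Γ ∘ₗ keepHom κ β S :=
      eq_of_eq_on_density hΓ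
    have hD : IsMarginal (glueEquiv κ S) (glueEquiv (fun _ => Fin d) S)
        (choi (Λ ∘ₗ tensorPure (∀ j, κ j) v))
        (choi (Γ ∘ₗ tensorPure (∀ j : {j // j ∈ S}, κ j) v)) := by
      intro u u' w w' o o' b b'
      have hk : keep S (Matrix.single (glue S u w) (glue S u' w') (1 : ℂ) ⊗ₖ pureState v) =
          if w = w' then Matrix.single u u' (1 : ℂ) ⊗ₖ pureState v else 0 := by
        have h1 : ∀ Y : Matrix (∀ j, κ j) (∀ j, κ j) ℂ,
            keep S (Y ⊗ₖ pureState v) = traceCompl S Y ⊗ₖ pureState v := by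
          intro Y
          ext p q
          simp [keep, traceCompl, Finset.sum_mul]
        rw [h1, traceCompl_single]
        split_ifs <;> simp
      have h := congrFun (congrFun (LinearMap.congr_fun hΓ'
        (Matrix.single (glue S u w) (glue S u' w') (1 : ℂ) ⊗ₖ pureState v)) (o, b)) (o', b')
      have h2 : (Γ ∘ₗ keepHom κ β S)
          (Matrix.single (glue S u w) (glue S u' w') (1 : ℂ) ⊗ₖ pureState v) =
          if w = w' then Γ (Matrix.single u u' (1 : ℂ) ⊗ₖ pureState v) else 0 := by
        refine (congrArg Γ hk).trans ?_
        split_ifs <;> simp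
      rw [h2] at h
      refine Eq.trans ?_ (h.trans ?_)
      · rfl
      · split_ifs <;> rfl
    exact causal_of_isMarginal (splits_glueEquiv S) (splits_glueEquiv S) hD

end Construction

end Teleportage

theorem mainTheorem6 {N d : ℕ} {κ : Fin N → Type*} [∀ j, Fintype (κ j)] [∀ j, DecidableEq (κ j)]
    [∀ j, Nonempty (κ j)] {β : Type*} [Fintype β] [DecidableEq β]
    (T : (Fin N → Fin d) → Matrix (∀ j, κ j) (∀ j, κ j) ℂ →ₗ[ℂ] Matrix β β ℂ)
    (hT : Teleportage.IsTeleportage T) :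
    (Teleportage.IsNonSignalling T ↔
      ∃ Λ : Matrix ((∀ j, κ j) × β) ((∀ j, κ j) × β) ℂ →ₗ[ℂ]
          Matrix ((Fin N → Fin d) × β) ((Fin N → Fin d) × β) ℂ,
        Teleportage.IsChannelDefinedBy T Λ ∧ Teleportage.HasUnitaryRep Λ) ∧
    (∀ Λ : Matrix ((∀ j, κ j) × β) ((∀ j, κ j) × β) ℂ →ₗ[ℂ]
          Matrix ((Fin N → Fin d) × β) ((Fin N → Fin d) × β) ℂ,
      Teleportage.HasUnitaryRep Λ → Teleportage.IsChannel Λ ∧ Teleportage.IsCausal Λ) ∧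
    (∀ (Λ : Matrix ((∀ j, κ j) × β) ((∀ j, κ j) × β) ℂ →ₗ[ℂ]
          Matrix ((Fin N → Fin d) × β) ((Fin N → Fin d) × β) ℂ)
      (bs : Fin N → OrthonormalBasis (Fin d) ℂ (EuclideanSpace ℂ (Fin d)))
      (ket0 : EuclideanSpace ℂ β),
      Teleportage.IsChannel Λ → Teleportage.IsCausal Λ → ‖ket0‖ = 1 →
      Teleportage.DefinedVia T Λ bs ket0 →
        Teleportage.HasUnitaryRep (Λ ∘ₗ Teleportage.resetBob ket0)) := by
  refine ⟨⟨fun hN => ?_, ?_⟩, fun Λ hΛ => ?_, fun Λ bs ket0 hΛ hcausal h0 _ => ?_⟩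
  · -- a unit vector in Bob's space exists because Bob's output states have trace one
    obtain ⟨b₀⟩ : Nonempty β := by
      obtain ⟨_, _, ρB, _, _, hρ, _⟩ := hN ∅
      by_contra hE
      rw [not_nonempty_iff] at hE
      simpa [Matrix.trace] using hρ.2
    have hC := Teleportage.IsNonSignalling.isCausalKernel hT hN
    refine ⟨Teleportage.kerMap (Teleportage.instrumentKernel T) ∘ₗ
      Teleportage.traceSndHom (∀ j, κ j) β,
      ⟨fun _ => EuclideanSpace.basisFun (Fin d) ℂ, EuclideanSpace.single b₀ 1, by simp, ?_⟩,
      Teleportage.hasUnitaryRep_of_causalKernel hC fun X => rfl⟩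
    exact (Teleportage.definedVia_iff (fun X => rfl) _ (by simp)).mpr
      Teleportage.eq_kerMap_outcomeKernel_instrumentKernel
  · rintro ⟨Λ, ⟨bs, ket0, h0, hdef⟩, hrep⟩
    obtain ⟨C, hC, hΛ⟩ := hrep.exists_causalKernel
    exact hC.isNonSignalling bs ((Teleportage.definedVia_iff hΛ bs h0).mp hdef)
  · obtain ⟨C, hC, hC'⟩ := hΛ.exists_causalKernel
    have h : Λ = Teleportage.kerMap C ∘ₗ Teleportage.traceSndHom (∀ j, κ j) β :=
      LinearMap.ext hC'
    rw [h]
    exact ⟨Teleportage.isChannel_kerMap_comp_traceSnd hC.posSemidef hC.unitTrace, hC.isCausal⟩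
  · refine Teleportage.hasUnitaryRep_of_causalKernel
      (Teleportage.isCausalKernel_of_isCausal hΛ hcausal h0) fun X => ?_
    rw [Teleportage.kerMap_choi]
    rfl
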